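/- Let $L^2(0,1)$ and $L^2(\mathbb{R})$ denote the usual Hilbert spaces of complex-valued functions with respect to Lebesgue measure. Let $C$ be the (bounded) Cesàro operator on $L^2(0,1)$, $$(Cf)(x) = \frac1x\int_0^x \frac{f(t)}{1-t}\,dt, \qquad 0<x<1,$$ let $\Phi : L^2(0,1)\to L^2(\mathbb{R})$ be the isometric isomorphism $$(\Phi f)(u) = \frac{e^{u/2}}{1+e^{u}}\, f\!\left(\frac{1}{1+e^{u}}\right), \qquad u\in\mathbb{R},$$ and let $\mathscr{F}$ be the unitary Fourier transform on $L^2(\mathbb{R})$ given by $(\mathscr{F}g)(s)=\frac{1}{\sqrt{2\pi}}\int_{-\infty}^{\infty} g(x)e^{-ixs}\,dx$ (for $g$ in the Schwartz space, and extended by continuity). Let $\mathcal{H}^2 = \mathscr{F}^{-1}(\chi_{(0,\infty)}L^2(\mathbb{R}))$ be the Hardy space of the real line. Let $\mathcal{M}$ be a closed subspace of $L^2(0,1)$. Then $\mathcal{M}$ is invariant for $C$, i.e. $C\mathcal{M}\subset\mathcal{M}$, if and only if either $$\mathcal{M} = \Phi^{-1}\big(\mathscr{F}^{-1}(\chi_A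 L^2(\mathbb{R}))\big)$$ for some measurable set $A\subset\mathbb{R}$, or $$\mathcal{M} = \Phi^{-1}\big(\mathscr{F}^{-1}(q\,\mathcal{H}^2)\big)$$ for some measurable function $q:\mathbb{R}\to\mathbb{C}$ with $|q|=1$. -/

import Mathlib

open MeasureTheory Set
open scoped ENNReal FourierTransform

noncomputable section

namespace CesaroL2

/-- The Hilbert space `L²(0, 1)` of complex-valued functions. -/
abbrev L2I : Type := Lp ℂ 2 (volume.restrict (Ioo (0 : ℝ) 1))

/-- The Hilbert space `L²(-∞, ∞)` of complex-valued functions. -/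
abbrev L2R : Type := Lp ℂ 2 (volume : Measure ℝ)

theorem eLpNorm_two_eq {μ : Measure ℝ} (f : ℝ → ℂ) :
    eLpNorm f 2 μ = (∫⁻ x, ‖f x‖ₑ ^ 2 ∂μ) ^ (1 / 2 : ℝ) := by
  rw [eLpNorm_eq_lintegral_rpow_enorm_toReal (by norm_num) (by norm_num)]
  simp

/-! ### The Cesàro operator -/

/-- `(C f)(x) = (1 / x) ∫₀ˣ f(t) / (1 - t) dt`. -/
def cesaroFun (f : ℝ → ℂ) (x : ℝ) : ℂ :=
  (1 / (x : ℂ)) * ∫ t in (0 : ℝ)..x, f t / (1 - (t : ℂ))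

theorem lintegral_Ioc_of_deriv {a b : ℝ} (hab : a ≤ b) {F f : ℝ → ℝ}
    (hc : ContinuousOn F (Icc a b)) (hd : ∀ x ∈ Ioo a b, HasDerivAt F (f x) x)
    (hf : ∀ x ∈ Ioo a b, 0 ≤ f x) :
    ∫⁻ x in Ioc a b, ENNReal.ofReal (f x) = ENNReal.ofReal (F b - F a) := by
  have hi : IntegrableOn f (Ioc a b) :=
    intervalIntegral.integrableOn_deriv_of_nonneg hc hd hf
  have h1 := intervalIntegral.integral_eq_sub_of_hasDerivAt_of_le hab hc hd
    ((intervalIntegrable_iff_integrableOn_Ioc_of_le hab).2 hi)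
  rw [intervalIntegral.integral_of_le hab] at h1
  rw [← h1, ofReal_integral_eq_lintegral_ofReal hi]
  rw [← restrict_Ioo_eq_restrict_Ioc]
  filter_upwards [ae_restrict_mem measurableSet_Ioo] with x hx using hf x hx

theorem schur_row {x : ℝ} (h0 : 0 < x) (h1 : x < 1) :
    ∫⁻ t in Ioc 0 x, ENNReal.ofReal (1 / ((1 - t) ^ 2 * √(t / (1 - t)))) =
      ENNReal.ofReal (2 * √(x / (1 - x))) := by
  rw [lintegral_Ioc_of_deriv (F := fun t => 2 * √(t / (1 - t))) h0.le]
  · simp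
  · apply ContinuousOn.mul continuousOn_const
    apply ContinuousOn.sqrt
    apply ContinuousOn.div continuousOn_id (by fun_prop)
    intro t ht; have := ht.2; linarith
  · intro t ht
    have a : 0 < t := ht.1
    have b : 0 < 1 - t := by linarith [ht.2]
    have e : HasDerivAt (fun t : ℝ => t / (1 - t)) (1 / (1 - t) ^ 2) t := by
      have := (hasDerivAt_id t).div ((hasDerivAt_id t).const_sub 1) b.ne'
      convert! this using 1
      simp
    have := (e.sqrt (by positivity)).const_mul 2
    convert! this using 1
    field_simp
  · intro t ht; positivity

theorem schur_col {t : ℝ} (h0 : 0 < t) (h1 : t < 1) :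
    ∫⁻ x in Ioc t 1, ENNReal.ofReal (1 / (x ^ 2 * √((1 - x) / x))) =
      ENNReal.ofReal (2 * √((1 - t) / t)) := by
  rw [lintegral_Ioc_of_deriv (F := fun t => - (2 * √((1 - t) / t))) h1.le]
  · simp
  · apply ContinuousOn.neg
    apply ContinuousOn.mul continuousOn_const
    apply ContinuousOn.sqrt
    apply ContinuousOn.div (by fun_prop) continuousOn_id
    intro s hs; have := hs.1; simp only [id]; linarith
  · intro s hs
    have a : 0 < s := by linarith [hs.1]
    have b : 0 < 1 - s := by linarith [hs.2]
    have e : HasDerivAt (fun t : ℝ => (1 - t) / t) (- (1 / s ^ 2)) s := by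
      have := ((hasDerivAt_id s).const_sub 1).div (hasDerivAt_id s) a.ne'
      convert! this using 1
      simp
      field_simp
      ring
    have := ((e.sqrt (by positivity)).const_mul 2).neg
    convert! this using 1
    field_simp
  · intro s hs
    have a : 0 < s := by linarith [hs.1]
    positivity

theorem sq_lintegral_mul_le {μ : Measure ℝ} {u v : ℝ → ℝ≥0∞} (hu : Measurable u)
    (hv : Measurable v) :
    (∫⁻ t, u t * v t ∂μ) ^ 2 ≤ (∫⁻ t, u t ^ 2 ∂μ) * ∫⁻ t, v t ^ 2 ∂μ := by
  have h := ENNReal.lintegral_mul_le_Lp_mul_Lq μ Real.HolderConjugate.two_two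
    hu.aemeasurable hv.aemeasurable
  calc _ ≤ ((∫⁻ t, u t ^ (2:ℝ) ∂μ) ^ (1 / 2 : ℝ) * (∫⁻ t, v t ^ (2:ℝ) ∂μ) ^ (1 / 2 : ℝ)) ^ 2 := by
        gcongr; exact h
    _ = _ := by
        rw [mul_pow, ← ENNReal.rpow_natCast, ← ENNReal.rpow_natCast, ← ENNReal.rpow_mul,
          ← ENNReal.rpow_mul]
        simp

theorem schur_pointwise {F : ℝ → ℝ≥0∞} (hF : Measurable F) {x : ℝ} (h0 : 0 < x) (h1 : x < 1) :
    (ENNReal.ofReal (1 / x) * ∫⁻ t in Ioc 0 x, F t * ENNReal.ofReal (1 / (1 - t))) ^ 2 ≤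
      ENNReal.ofReal (2 * (1 / (x ^ 2 * √((1 - x) / x)))) *
        ∫⁻ t in Ioc 0 x, F t ^ 2 * ENNReal.ofReal (√(t / (1 - t))) := by
  have key : (∫⁻ t in Ioc 0 x, F t * ENNReal.ofReal (1 / (1 - t))) ^ 2 ≤
      ENNReal.ofReal (2 * √(x / (1 - x))) *
        ∫⁻ t in Ioc 0 x, F t ^ 2 * ENNReal.ofReal (√(t / (1 - t))) := by
    have := sq_lintegral_mul_le (μ := volume.restrict (Ioc 0 x))
      (u := fun t => ENNReal.ofReal (√(1 / ((1 - t) ^ 2 * √(t / (1 - t))))))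
      (v := fun t => F t * ENNReal.ofReal (√(√(t / (1 - t))))) (by fun_prop) (by fun_prop)
    rw [← schur_row h0 h1]
    refine le_trans (le_of_eq ?_) (this.trans (le_of_eq ?_))
    · congr 1
      refine setLIntegral_congr_fun measurableSet_Ioc fun t ht => ?_
      have a : 0 < t := ht.1
      have b : 0 < 1 - t := by linarith [ht.2]
      rw [mul_left_comm, ← ENNReal.ofReal_mul (by positivity), ← Real.sqrt_mul (by positivity)]
      congr 2
      rw [show 1 / ((1 - t) ^ 2 * √(t / (1 - t))) * √(t / (1 - t)) = (1 / (1 - t)) ^ 2 by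
        field_simp, Real.sqrt_sq (by positivity)]
    · congr 1
      · refine setLIntegral_congr_fun measurableSet_Ioc fun t ht => ?_
        have a : 0 < t := ht.1
        have b : 0 < 1 - t := by linarith [ht.2]
        rw [← ENNReal.ofReal_pow (by positivity), Real.sq_sqrt (by positivity)]
      · refine setLIntegral_congr_fun measurableSet_Ioc fun t ht => ?_
        have a : 0 < t := ht.1
        have b : 0 < 1 - t := by linarith [ht.2]
        rw [mul_pow, ← ENNReal.ofReal_pow (by positivity), Real.sq_sqrt (by positivity)]
  rw [mul_pow]
  calc _ ≤ ENNReal.ofReal (1 / x) ^ 2 * (ENNReal.ofReal (2 * √(x / (1 - x))) *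
        ∫⁻ t in Ioc 0 x, F t ^ 2 * ENNReal.ofReal (√(t / (1 - t)))) := by gcongr
    _ = _ := by
      rw [← mul_assoc, ← ENNReal.ofReal_pow (by positivity), ← ENNReal.ofReal_mul (by positivity)]
      congr 2
      have b : 0 < 1 - x := by linarith
      rw [show (1 - x) / x = (x / (1 - x))⁻¹ by simp, Real.sqrt_inv]
      field_simp

theorem schur_bound {F : ℝ → ℝ≥0∞} (hF : Measurable F) :
    ∫⁻ x in Ioo 0 1, (ENNReal.ofReal (1 / x) *
      ∫⁻ t in Ioc 0 x, F t * ENNReal.ofReal (1 / (1 - t))) ^ 2 ≤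
      4 * ∫⁻ t in Ioo 0 1, F t ^ 2 := by
  let K : ℝ → ℝ → ℝ≥0∞ := fun x t =>
    {p : ℝ × ℝ | p.2 ≤ p.1}.indicator (fun p =>
      ENNReal.ofReal (2 * (1 / (p.1 ^ 2 * √((1 - p.1) / p.1)))) *
        (F p.2 ^ 2 * ENNReal.ofReal (√(p.2 / (1 - p.2))))) (x, t)
  have hK : Measurable (Function.uncurry K) := by
    apply Measurable.indicator (by fun_prop)
    exact measurableSet_le measurable_snd measurable_fst
  calc _ ≤ ∫⁻ x in Ioo (0:ℝ) 1, ∫⁻ t in Ioo (0:ℝ) 1, K x t := by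
        refine setLIntegral_mono' measurableSet_Ioo fun x hx => ?_
        refine (schur_pointwise hF hx.1 hx.2).trans ?_
        rw [← lintegral_const_mul _ (by fun_prop)]
        calc _ = ∫⁻ t in Ioc 0 x, K x t := by
              refine setLIntegral_congr_fun measurableSet_Ioc fun t ht => ?_
              simp [K, ht.2]
          _ ≤ _ := lintegral_mono_set (show Ioc 0 x ⊆ Ioo 0 1 from
              fun t ht => ⟨ht.1, ht.2.trans_lt hx.2⟩)
    _ = ∫⁻ t in Ioo (0:ℝ) 1, ∫⁻ x in Ioo (0:ℝ) 1, K x t := lintegral_lintegral_swap hK.aemeasurable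
    _ ≤ ∫⁻ t in Ioo (0:ℝ) 1, 4 * F t ^ 2 := by
        refine setLIntegral_mono' measurableSet_Ioo fun t ht => ?_
        have a : 0 < t := ht.1
        have b : 0 < 1 - t := by linarith [ht.2]
        calc ∫⁻ x in Ioo (0:ℝ) 1, K x t
            ≤ ∫⁻ x in Icc t 1, ENNReal.ofReal (1 / (x ^ 2 * √((1 - x) / x))) *
                (2 * (F t ^ 2 * ENNReal.ofReal (√(t / (1 - t))))) := by
              rw [← lintegral_indicator measurableSet_Ioo, ← lintegral_indicator measurableSet_Icc]
              refine lintegral_mono fun x => ?_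
              by_cases h : x ∈ Ioo (0:ℝ) 1
              · by_cases h' : t ≤ x
                · rw [indicator_of_mem h, indicator_of_mem (show x ∈ Icc t 1 from ⟨h', h.2.le⟩)]
                  simp only [K]
                  rw [indicator_of_mem (show (x, t) ∈ {p : ℝ × ℝ | p.2 ≤ p.1} from h')]
                  simp only
                  rw [ENNReal.ofReal_mul (by norm_num)]
                  simp only [ENNReal.ofReal_ofNat]
                  rw [mul_comm 2, mul_assoc]
                · rw [indicator_of_mem h]
                  simp [K, h']
              · simp [h]
          _ = ENNReal.ofReal (2 * √((1 - t) / t)) *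
                (2 * (F t ^ 2 * ENNReal.ofReal (√(t / (1 - t))))) := by
              rw [lintegral_mul_const _ (by fun_prop), ← schur_col ht.1 ht.2,
                restrict_Ioc_eq_restrict_Icc]
          _ = ENNReal.ofReal (2 * √((1 - t) / t) * √(t / (1 - t))) * 2 * F t ^ 2 := by
              rw [ENNReal.ofReal_mul (p := 2 * √((1 - t) / t)) (by positivity)]; ring
          _ ≤ 4 * F t ^ 2 := by
              rw [mul_assoc 2, ← Real.sqrt_mul (by positivity),
                show (1 - t) / t * (t / (1 - t)) = 1 by field_simp]
              simp only [Real.sqrt_one, mul_one, ENNReal.ofReal_ofNat]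
              norm_num
    _ = _ := lintegral_const_mul _ (by fun_prop)

theorem measurable_cesaroFun {f : ℝ → ℂ} (hf : Measurable f) :
    AEStronglyMeasurable (cesaroFun f) (volume.restrict (Ioo (0 : ℝ) 1)) := by
  have h1 : StronglyMeasurable fun x : ℝ =>
      (1 / (x : ℂ)) * ∫ t, {p : ℝ × ℝ | 0 < p.2 ∧ p.2 ≤ p.1}.indicator
        (fun p => f p.2 / (1 - (p.2 : ℂ))) (x, t) := by
    apply StronglyMeasurable.mul
    · exact (by fun_prop : Measurable fun x : ℝ => 1 / (x : ℂ)).stronglyMeasurable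
    · apply StronglyMeasurable.integral_prod_right
        (f := fun x t => {p : ℝ × ℝ | 0 < p.2 ∧ p.2 ≤ p.1}.indicator
          (fun p => f p.2 / (1 - (p.2 : ℂ))) (x, t))
      apply Measurable.stronglyMeasurable
      apply Measurable.indicator (by fun_prop)
      exact (measurableSet_lt measurable_const measurable_snd).inter
        (measurableSet_le measurable_snd measurable_fst)
  refine h1.aestronglyMeasurable.congr ?_
  filter_upwards [ae_restrict_mem measurableSet_Ioo] with x hx
  rw [cesaroFun, intervalIntegral.integral_of_le hx.1.le, ← integral_indicator measurableSet_Ioc]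
  congr 2

theorem enorm_cesaroFun_le (f : ℝ → ℂ) {x : ℝ} (hx : x ∈ Ioo (0 : ℝ) 1) :
    ‖cesaroFun f x‖ₑ ≤
      ENNReal.ofReal (1 / x) * ∫⁻ t in Ioc 0 x, ‖f t‖ₑ * ENNReal.ofReal (1 / (1 - t)) := by
  rw [cesaroFun, enorm_mul, intervalIntegral.integral_of_le hx.1.le]
  gcongr
  · rw [← ofReal_norm]
    simp [abs_of_pos hx.1]
  · refine (enorm_integral_le_lintegral_enorm _).trans (le_of_eq ?_)
    refine setLIntegral_congr_fun measurableSet_Ioc fun t ht => ?_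
    have b : 0 < 1 - t := by linarith [ht.2, hx.2]
    rw [div_eq_mul_one_div, enorm_mul]
    congr 1
    rw [← ofReal_norm]
    congr 1
    rw [show (1 - (t : ℂ)) = ((1 - t : ℝ) : ℂ) by push_cast; rfl, norm_div, Complex.norm_real,
      Real.norm_of_nonneg b.le, norm_one]

theorem eLpNorm_cesaroFun_le {f : ℝ → ℂ} (hf : Measurable f) :
    eLpNorm (cesaroFun f) 2 (volume.restrict (Ioo (0 : ℝ) 1)) ≤
      2 * eLpNorm f 2 (volume.restrict (Ioo (0 : ℝ) 1)) := by
  rw [eLpNorm_two_eq, eLpNorm_two_eq]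
  calc _ ≤ (4 * ∫⁻ t in Ioo (0 : ℝ) 1, ‖f t‖ₑ ^ 2) ^ (1 / 2 : ℝ) := by
        gcongr
        refine le_trans (setLIntegral_mono' measurableSet_Ioo fun x hx => ?_)
          (schur_bound hf.enorm)
        gcongr
        exact enorm_cesaroFun_le f hx
    _ = _ := by
        rw [ENNReal.mul_rpow_of_nonneg _ _ (by norm_num)]
        congr 1
        rw [show (4 : ℝ≥0∞) = 2 ^ (2 : ℝ) by norm_num, ← ENNReal.rpow_mul]
        norm_num

theorem memLp_cesaroFun (f : L2I) :
    MemLp (cesaroFun f) 2 (volume.restrict (Ioo (0 : ℝ) 1)) := by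
  have hm := (Lp.stronglyMeasurable f).measurable
  refine ⟨measurable_cesaroFun hm, (eLpNorm_cesaroFun_le hm).trans_lt ?_⟩
  exact ENNReal.mul_lt_top (by norm_num) (Lp.memLp f).2

theorem intervalIntegrable_cesaro (f : L2I) {x : ℝ} (hx : x ∈ Ioo (0 : ℝ) 1) :
    IntervalIntegrable (fun t => f t / (1 - (t : ℂ))) volume 0 x := by
  rw [intervalIntegrable_iff_integrableOn_Ioc_of_le hx.1.le]
  have h : IntegrableOn f (Ioc 0 x) := by
    have : IntegrableOn f (Ioo 0 1) := (Lp.memLp f).integrable (by norm_num)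
    exact this.mono_set fun t ht => ⟨ht.1, ht.2.trans_lt hx.2⟩
  have h' := h.bdd_mul (c := 1 / (1 - x)) (f := fun t : ℝ => 1 / (1 - (t : ℂ)))
    (by fun_prop : Measurable fun t : ℝ => 1 / (1 - (t : ℂ))).aestronglyMeasurable ?_
  · refine h'.congr (ae_of_all _ fun t => ?_)
    simp only
    ring
  · filter_upwards [ae_restrict_mem measurableSet_Ioc] with t ht
    have b : 0 < 1 - t := by linarith [ht.2, hx.2]
    rw [show (1 - (t : ℂ)) = ((1 - t : ℝ) : ℂ) by push_cast; rfl, norm_div, Complex.norm_real,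
      Real.norm_of_nonneg b.le, norm_one]
    exact one_div_le_one_div_of_le (by linarith [hx.2]) (by linarith [ht.2])

theorem cesaroFun_congr {f g : ℝ → ℂ} (h : f =ᵐ[volume.restrict (Ioo (0 : ℝ) 1)] g) {x : ℝ}
    (hx : x ∈ Ioo (0 : ℝ) 1) : cesaroFun f x = cesaroFun g x := by
  rw [cesaroFun, cesaroFun, intervalIntegral.integral_of_le hx.1.le,
    intervalIntegral.integral_of_le hx.1.le]
  congr 1
  refine integral_congr_ae ?_
  have h' := ae_restrict_of_ae_restrict_of_subset
    (show Ioc 0 x ⊆ Ioo (0 : ℝ) 1 from fun t ht => ⟨ht.1, ht.2.trans_lt hx.2⟩) h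
  filter_upwards [h'] with t ht
  rw [ht]

/-- The Cesàro operator `C` on `L²(0, 1)`. -/
def cesaro : L2I →L[ℂ] L2I :=
  LinearMap.mkContinuous
    { toFun := fun f => (memLp_cesaroFun f).toLp (cesaroFun f)
      map_add' := fun f g => by
        rw [← MemLp.toLp_add]
        apply MemLp.toLp_congr
        filter_upwards [ae_restrict_mem measurableSet_Ioo] with x hx
        rw [cesaroFun_congr (Lp.coeFn_add f g) hx]
        simp only [cesaroFun, Pi.add_apply, add_div]
        rw [intervalIntegral.integral_add (intervalIntegrable_cesaro f hx)
          (intervalIntegrable_cesaro g hx), mul_add]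
      map_smul' := fun c f => by
        rw [RingHom.id_apply, ← MemLp.toLp_const_smul]
        apply MemLp.toLp_congr
        filter_upwards [ae_restrict_mem measurableSet_Ioo] with x hx
        rw [cesaroFun_congr (Lp.coeFn_smul c f) hx]
        simp only [cesaroFun, Pi.smul_apply, smul_eq_mul, mul_div_assoc]
        rw [intervalIntegral.integral_const_mul]
        ring }
    2 fun f => by
      simp only [LinearMap.coe_mk, AddHom.coe_mk]
      rw [Lp.norm_toLp, Lp.norm_def]
      have h := eLpNorm_cesaroFun_le (Lp.stronglyMeasurable f).measurable
      have h2 := ENNReal.toReal_mono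
        (ENNReal.mul_lt_top (by norm_num) (Lp.memLp f).2).ne h
      simpa using h2

theorem coeFn_cesaro (f : L2I) :
    cesaro f =ᵐ[volume.restrict (Ioo (0 : ℝ) 1)] cesaroFun f :=
  (memLp_cesaroFun f).coeFn_toLp

/-! ### Weighted composition operators -/

section WeightedComposition

variable {μ ν : Measure ℝ} {w : ℝ → ℂ} {τ σ : ℝ → ℝ}

/-- The weighted composition `u ↦ w(u) f(τ(u))`. -/
def weightedComp (w : ℝ → ℂ) (τ : ℝ → ℝ) (f : ℝ → ℂ) (u : ℝ) : ℂ := w u * f (τ u)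

/-- The data making `f ↦ w · (f ∘ τ)` an isometric isomorphism of `L²(μ)` onto `L²(ν)`: the
weight has no zero, `τ` has a measurable left inverse `σ`, and `μ` is the image under `τ`
of `|w|² ν`. -/
structure IsChangeOfVariables (μ ν : Measure ℝ) (w : ℝ → ℂ) (τ σ : ℝ → ℝ) : Prop where
  measurable_w : Measurable w
  measurable_τ : Measurable τ
  measurable_σ : Measurable σ
  w_ne_zero : ∀ u, w u ≠ 0
  left_inv : ∀ u, σ (τ u) = u
  lintegral_eq : ∀ g : ℝ → ℝ≥0∞, ∫⁻ x, g x ∂μ = ∫⁻ u, ‖w u‖ₑ ^ 2 * g (τ u) ∂ν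

theorem IsChangeOfVariables.qmp (h : IsChangeOfVariables μ ν w τ σ) :
    Measure.QuasiMeasurePreserving τ ν μ := by
  have hw := h.measurable_w
  have hτ := h.measurable_τ
  refine ⟨hτ, Measure.AbsolutelyContinuous.mk fun s hs h0 => ?_⟩
  have h1 := h.lintegral_eq (s.indicator 1)
  rw [lintegral_indicator_one hs, h0, eq_comm, lintegral_eq_zero_iff] at h1
  · rw [Measure.map_apply hτ hs]
    refine measure_mono_null ?_ h1
    intro u hu hu'
    have : ‖w u‖ₑ ^ 2 * s.indicator (1 : ℝ → ℝ≥0∞) (τ u) = 0 := hu'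
    rw [indicator_of_mem (show τ u ∈ s from hu)] at this
    simp [h.w_ne_zero u] at this
  · exact (by fun_prop : Measurable fun u => ‖w u‖ₑ ^ 2).mul
      ((measurable_one.indicator hs).comp hτ)

theorem IsChangeOfVariables.eLpNorm_eq (h : IsChangeOfVariables μ ν w τ σ) (f : ℝ → ℂ) :
    eLpNorm (weightedComp w τ f) 2 ν = eLpNorm f 2 μ := by
  rw [eLpNorm_two_eq, eLpNorm_two_eq, h.lintegral_eq]
  simp only [weightedComp, enorm_mul, mul_pow]

theorem IsChangeOfVariables.memLp (h : IsChangeOfVariables μ ν w τ σ) {f : ℝ → ℂ}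
    (hf : MemLp f 2 μ) : MemLp (weightedComp w τ f) 2 ν :=
  ⟨h.measurable_w.aestronglyMeasurable.mul (hf.1.comp_quasiMeasurePreserving h.qmp),
    by rw [h.eLpNorm_eq]; exact hf.2⟩

theorem IsChangeOfVariables.congr (h : IsChangeOfVariables μ ν w τ σ) {f g : ℝ → ℂ}
    (hfg : f =ᵐ[μ] g) : weightedComp w τ f =ᵐ[ν] weightedComp w τ g := by
  filter_upwards [h.qmp.ae_eq hfg] with u hu
  simp only [weightedComp]
  rw [show f (τ u) = g (τ u) from hu]

/-- The isometric isomorphism `f ↦ w · (f ∘ τ)` of `L²(μ)` onto `L²(ν)`. -/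
def IsChangeOfVariables.toEquiv (h : IsChangeOfVariables μ ν w τ σ) :
    Lp ℂ 2 μ ≃ₗᵢ[ℂ] Lp ℂ 2 ν :=
  LinearIsometryEquiv.ofSurjective
    { toFun := fun f => (h.memLp (Lp.memLp f)).toLp (weightedComp w τ f)
      map_add' := fun f g => by
        rw [← MemLp.toLp_add]
        apply MemLp.toLp_congr
        filter_upwards [h.congr (Lp.coeFn_add f g)] with u hu
        rw [hu]
        simp [weightedComp, mul_add]
      map_smul' := fun c f => by
        rw [RingHom.id_apply, ← MemLp.toLp_const_smul]
        apply MemLp.toLp_congr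
        filter_upwards [h.congr (Lp.coeFn_smul c f)] with u hu
        rw [hu]
        simp [weightedComp, mul_left_comm]
      norm_map' := fun f => by
        simp only [LinearMap.coe_mk, AddHom.coe_mk]
        rw [Lp.norm_toLp, Lp.norm_def, h.eLpNorm_eq] }
    (by
      intro g
      let f : ℝ → ℂ := fun x => g (σ x) / w (σ x)
      have hfg : weightedComp w τ f = g := by
        funext u
        simp only [weightedComp, f, h.left_inv]
        exact mul_div_cancel₀ _ (h.w_ne_zero u)
      have hf : MemLp f 2 μ := by
        refine ⟨?_, ?_⟩
        · exact ((((Lp.stronglyMeasurable g).measurable.comp h.measurable_σ).div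
            (h.measurable_w.comp h.measurable_σ))).aestronglyMeasurable
        · rw [← h.eLpNorm_eq, hfg]; exact (Lp.memLp g).2
      refine ⟨hf.toLp f, ?_⟩
      apply Lp.ext
      refine (MemLp.coeFn_toLp (h.memLp (Lp.memLp (hf.toLp f)))).trans ((h.congr hf.coeFn_toLp).trans ?_)
      rw [hfg])

theorem IsChangeOfVariables.coeFn_toEquiv (h : IsChangeOfVariables μ ν w τ σ) (f : Lp ℂ 2 μ) :
    h.toEquiv f =ᵐ[ν] weightedComp w τ f :=
  (h.memLp (Lp.memLp f)).coeFn_toLp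

end WeightedComposition

/-! ### The isometric isomorphism `Φ` of `L²(0, 1)` onto `L²(-∞, ∞)` -/

theorem isChangeOfVariables_logistic :
    IsChangeOfVariables (volume.restrict (Ioo (0 : ℝ) 1)) volume
      (fun u => ((Real.exp (u / 2) / (1 + Real.exp u) : ℝ) : ℂ))
      (fun u => 1 / (1 + Real.exp u)) (fun x => Real.log ((1 - x) / x)) where
  measurable_w := by fun_prop
  measurable_τ := by fun_prop
  measurable_σ := by fun_prop
  w_ne_zero u := by
    rw [Complex.ofReal_ne_zero]; positivity
  left_inv u := by
    have h : (1 - 1 / (1 + Real.exp u)) / (1 / (1 + Real.exp u)) = Real.exp u := by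
      field_simp; ring
    simp only [h, Real.log_exp]
  lintegral_eq g := by
    have himg : (fun u : ℝ => 1 / (1 + Real.exp u)) '' univ = Ioo (0 : ℝ) 1 := by
      ext x
      simp only [image_univ, mem_range, mem_Ioo]
      constructor
      · rintro ⟨u, rfl⟩
        have := Real.exp_pos u
        exact ⟨by positivity, by rw [div_lt_one (by positivity)]; linarith⟩
      · rintro ⟨h0, h1⟩
        refine ⟨Real.log ((1 - x) / x), ?_⟩
        rw [Real.exp_log (div_pos (by linarith) h0)]
        field_simp
        ring
    have hinj : InjOn (fun u : ℝ => 1 / (1 + Real.exp u)) univ := by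
      intro u _ v _ huv
      simp only at huv
      have := Real.exp_pos u
      have := Real.exp_pos v
      rw [div_eq_div_iff (by positivity) (by positivity)] at huv
      exact Real.exp_injective (by linarith)
    rw [← himg, lintegral_image_eq_lintegral_abs_deriv_mul MeasurableSet.univ
      (f' := fun u => -(Real.exp u / (1 + Real.exp u) ^ 2)) _ hinj, Measure.restrict_univ]
    · refine lintegral_congr fun u => ?_
      congr 1
      rw [← ofReal_norm, ← ENNReal.ofReal_pow (norm_nonneg _), Complex.norm_real,
        Real.norm_of_nonneg (by positivity), abs_neg, abs_of_nonneg (by positivity), div_pow,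
        ← Real.exp_nat_mul]
      congr 3
      push_cast
      ring
    · intro u _
      have h1 : HasDerivAt (fun u => 1 + Real.exp u) (Real.exp u) u :=
        (Real.hasDerivAt_exp u).const_add 1
      have h2 := h1.inv (by positivity)
      simp only [one_div]
      convert! h2.hasDerivWithinAt using 1
      ring

/-- `(Φ f)(u) = (e^{u/2} / (1 + e^u)) f(1 / (1 + e^u))`, as an isometric isomorphism of
`L²(0, 1)` onto `L²(-∞, ∞)`. -/
def Phi : L2I ≃ₗᵢ[ℂ] L2R := isChangeOfVariables_logistic.toEquiv

theorem coeFn_Phi (f : L2I) :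
    Phi f =ᵐ[volume] fun u : ℝ =>
      ((Real.exp (u / 2) / (1 + Real.exp u) : ℝ) : ℂ) * f (1 / (1 + Real.exp u)) :=
  isChangeOfVariables_logistic.coeFn_toEquiv f

/-! ### The Fourier transform `(𝓕 g)(s) = (2π)^{-1/2} ∫ g(x) e^{-ixs} dx` on `L²(-∞, ∞)` -/

theorem isChangeOfVariables_dilation :
    IsChangeOfVariables volume volume
      (fun _ => (((√(2 * Real.pi))⁻¹ : ℝ) : ℂ)) (fun s => s / (2 * Real.pi))
      (fun x => x * (2 * Real.pi)) where
  measurable_w := by fun_prop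
  measurable_τ := by fun_prop
  measurable_σ := by fun_prop
  w_ne_zero u := by
    rw [Complex.ofReal_ne_zero]; positivity
  left_inv u := by
    field_simp
  lintegral_eq g := by
    have himg : (fun s : ℝ => s / (2 * Real.pi)) '' univ = univ := by
      rw [image_univ]
      exact Function.Surjective.range_eq fun x => ⟨x * (2 * Real.pi), by field_simp⟩
    have hinj : InjOn (fun s : ℝ => s / (2 * Real.pi)) univ := by
      intro u _ v _ huv
      simpa [Real.pi_ne_zero] using huv
    have h := lintegral_image_eq_lintegral_abs_deriv_mul MeasurableSet.univ
      (f' := fun _ => 1 / (2 * Real.pi))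
      (fun u _ => ((hasDerivAt_id u).div_const (2 * Real.pi)).hasDerivWithinAt) hinj g
    simp only [id, himg, Measure.restrict_univ] at h
    rw [h]
    refine lintegral_congr fun u => ?_
    congr 1
    rw [← ofReal_norm, ← ENNReal.ofReal_pow (norm_nonneg _), Complex.norm_real,
      Real.norm_of_nonneg (by positivity), abs_of_nonneg (by positivity), inv_pow,
      Real.sq_sqrt (by positivity), one_div]

/-- The Fourier transform on `L²(-∞, ∞)` in the unitary normalization with angular frequency.
Mathlib's `𝓕` has kernel `e^{-2πixs}`, so this is `s ↦ (2π)^{-1/2} (𝓕 g)(s / (2π))`. -/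
def fourierL2 : L2R ≃ₗᵢ[ℂ] L2R :=
  (Lp.fourierTransformₗᵢ ℝ ℂ).trans isChangeOfVariables_dilation.toEquiv

/-- On Schwartz functions the transform is given by the integral formula. -/
theorem fourierL2_schwartz (g : SchwartzMap ℝ ℂ) :
    fourierL2 (g.toLp 2) =ᵐ[volume] fun s : ℝ =>
      (((√(2 * Real.pi))⁻¹ : ℝ) : ℂ) *
        ∫ x : ℝ, g x * Complex.exp (-Complex.I * (x : ℂ) * (s : ℂ)) := by
  have h1 : fourierL2 (g.toLp 2) =
      isChangeOfVariables_dilation.toEquiv ((𝓕 g).toLp 2) := by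
    rw [← SchwartzMap.toLp_fourier_eq]; rfl
  rw [h1]
  refine (isChangeOfVariables_dilation.coeFn_toEquiv _).trans
    ((isChangeOfVariables_dilation.congr ((𝓕 g).coeFn_toLp 2 volume)).trans (ae_of_all _ fun s => ?_))
  simp only [weightedComp]
  congr 1
  rw [SchwartzMap.fourier_coe, Real.fourier_eq']
  refine integral_congr_ae (ae_of_all _ fun x => ?_)
  simp only [smul_eq_mul]
  rw [mul_comm]
  congr 2
  simp only [RCLike.inner_apply, conj_trivial]
  push_cast
  field_simp

/-! ### Subspaces -/

/-- `φ 𝓝 = {φ g : g ∈ 𝓝}` (inside `L²(-∞, ∞)`), for a function `φ` and a subspace `𝓝`. -/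
def mulSubspace (φ : ℝ → ℂ) (N : Submodule ℂ L2R) : Submodule ℂ L2R where
  carrier := {h | ∃ g ∈ N, h =ᵐ[volume] fun x => φ x * g x}
  add_mem' := by
    rintro a b ⟨g, hg, ha⟩ ⟨g', hg', hb⟩
    refine ⟨g + g', N.add_mem hg hg', ?_⟩
    filter_upwards [ha, hb, Lp.coeFn_add a b, Lp.coeFn_add g g'] with x h1 h2 h3 h4
    rw [h3, h4, Pi.add_apply, Pi.add_apply, h1, h2, mul_add]
  zero_mem' := by
    refine ⟨0, N.zero_mem, ?_⟩
    filter_upwards [Lp.coeFn_zero ℂ 2 (volume : Measure ℝ)] with x h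
    simp
  smul_mem' := by
    rintro c a ⟨g, hg, ha⟩
    refine ⟨c • g, N.smul_mem c hg, ?_⟩
    filter_upwards [ha, Lp.coeFn_smul c a, Lp.coeFn_smul c g] with x h1 h2 h3
    rw [h2, h3, Pi.smul_apply, Pi.smul_apply, h1, smul_eq_mul, smul_eq_mul, mul_left_comm]

/-- `χ_A L²(-∞, ∞)`. -/
def indicatorL2 (A : Set ℝ) : Submodule ℂ L2R := mulSubspace (A.indicator 1) ⊤

/-- The inverse Fourier transform `𝓕⁻¹ N` of a subspace `N`. -/
def fourierInvSubspace (N : Submodule ℂ L2R) : Submodule ℂ L2R :=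
  N.map (fourierL2.symm.toLinearEquiv : L2R →ₗ[ℂ] L2R)

/-- The image `Φ⁻¹ N` of a subspace `N` of `L²(-∞, ∞)`. -/
def phiInvSubspace (N : Submodule ℂ L2R) : Submodule ℂ L2I :=
  N.map (Phi.symm.toLinearEquiv : L2R →ₗ[ℂ] L2I)

/-- The Hardy space of the real line, `𝓗² = 𝓕⁻¹ (χ_{(0, ∞)} L²(-∞, ∞))`. -/
def hardy : Submodule ℂ L2R := fourierInvSubspace (indicatorL2 (Ioi 0))

end CesaroL2

end

noncomputable section

namespace CesaroL2

/-! ### Multiplication by unimodular functions -/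

/-! Put `U = 𝓕 Φ` (`spectralMap`). On Schwartz functions `Φ C Φ⁻¹` inverts the differential operator
`G ↦ G / 2 - G'`, whose Fourier symbol is `1 / 2 - is`. Hence `U C U⁻¹` is multiplication by `1 / (1
/ 2 - is) = 1 - φ(s)`, where `φ` is unimodular, injective on the line and tends to `1` at both ends
(`spectralMap_cesaro`). A subspace is invariant under `C` exactly when it is invariant under `1 -
C`, so the question becomes that of the closed subspaces `N` of `L²(ℝ)` with `φ N ⊆ N`: a theorem of
Beurling–Helson–Lax type.

The analytic tool is uniqueness of moments: an integrable `h` with `∫ φⁿ h = 0` for every integer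
`n` vanishes a.e. (`HasZeroMoments.ae_eq_zero`). Consequently, if `f` is orthogonal to all `φⁿ g`,
then `f` and `g` have disjoint supports.

If also `φ⁻¹ N ⊆ N`, projecting a nowhere vanishing vector to `N` produces the set `A` with `N = χ_A
L²` (`exists_eq_indicatorL2`).

Otherwise `φ N` is a proper closed subspace of `N`, and a unit vector `ψ` of `N` orthogonal to it is
called wandering. The moments `∫ φⁿ |ψ|²` vanish for `n ≠ 0`, and so do those of `|1 - φ|²`, because
`(φⁿ)' = i n φⁿ |1 - φ|²`. Thus `|ψ|²` is the same multiple of `|1 - φ|²` for every such `N`.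
Moreover `N` is the least closed `φ`-invariant subspace containing `ψ`. Two subspaces of this kind
therefore differ by the unimodular quotient of their wandering vectors (`exists_eq_mulSubspace`).

It remains to see that `𝓗²` is one of them. Since `𝓕²` is reflection, `U⁻¹ 𝓗²` consists of the
functions vanishing on `(0, 1/2]`. This space is visibly `C`-invariant, and its orthogonal
complement is not. -/

theorem isChangeOfVariables_unimodular {q : ℝ → ℂ} (hq : Measurable q) (h1 : ∀ x, ‖q x‖ = 1) :
    IsChangeOfVariables volume volume q id id where
  measurable_w := hq
  measurable_τ := measurable_id
  measurable_σ := measurable_id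
  w_ne_zero u := by
    rw [← norm_ne_zero_iff, h1]; exact one_ne_zero
  left_inv u := rfl
  lintegral_eq g := by
    refine lintegral_congr fun u => ?_
    rw [← ofReal_norm, h1]
    simp

/-- Multiplication by a unimodular function, as a unitary operator. -/
def unimodMul {q : ℝ → ℂ} (hq : Measurable q) (h1 : ∀ x, ‖q x‖ = 1) : L2R ≃ₗᵢ[ℂ] L2R :=
  (isChangeOfVariables_unimodular hq h1).toEquiv

theorem coeFn_unimodMul {q : ℝ → ℂ} (hq : Measurable q) (h1 : ∀ x, ‖q x‖ = 1) (f : L2R) :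
    unimodMul hq h1 f =ᵐ[volume] fun x => q x * f x :=
  (isChangeOfVariables_unimodular hq h1).coeFn_toEquiv f

/-- The inner function `φ(s) = -(1/2 + is)/(1/2 - is)` of the upper half-plane. -/
def phi (s : ℝ) : ℂ := -(1 / 2 + Complex.I * s) / (1 / 2 - Complex.I * s)

theorem half_sub_ne_zero (s : ℝ) : (1 / 2 - Complex.I * s : ℂ) ≠ 0 := by
  intro h
  have := congrArg Complex.re h
  norm_num at this

theorem half_add_ne_zero (s : ℝ) : (1 / 2 + Complex.I * s : ℂ) ≠ 0 := by
  intro h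
  have := congrArg Complex.re h
  norm_num at this

theorem continuous_phi : Continuous phi := by
  unfold phi
  exact Continuous.div (by fun_prop) (by fun_prop) half_sub_ne_zero

theorem norm_phi (s : ℝ) : ‖phi s‖ = 1 := by
  have h : (1 / 2 - Complex.I * s : ℂ) = (starRingEnd ℂ) (1 / 2 + Complex.I * s) := by
    rw [show (1 / 2 + Complex.I * s : ℂ) = ((1 / 2 : ℝ) : ℂ) + Complex.I * s by push_cast; rfl,
      map_add, map_mul, Complex.conj_ofReal, Complex.conj_ofReal, Complex.conj_I]
    push_cast; ring
  rw [phi, norm_div, norm_neg, h, RCLike.norm_conj, div_self]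
  exact norm_ne_zero_iff.2 (half_add_ne_zero s)

theorem phi_ne_zero (s : ℝ) : phi s ≠ 0 := by
  rw [← norm_ne_zero_iff, norm_phi]; exact one_ne_zero

theorem one_sub_phi (s : ℝ) : 1 - phi s = 1 / (1 / 2 - Complex.I * s) := by
  have := half_sub_ne_zero s
  rw [phi, eq_div_iff this, sub_mul, div_mul_cancel₀ _ this]
  ring

theorem phi_injective : Function.Injective phi := by
  intro s t h
  have h2 : 1 - phi s = 1 - phi t := by rw [h]
  rw [one_sub_phi, one_sub_phi] at h2
  simp only [one_div, inv_inj, sub_right_inj] at h2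
  exact_mod_cast mul_left_cancel₀ Complex.I_ne_zero h2

theorem conj_phi (s : ℝ) : (starRingEnd ℂ) (phi s) = (phi s)⁻¹ := by
  rw [Complex.inv_def, Complex.normSq_eq_norm_sq, norm_phi]; simp

theorem measurable_phi_zpow (n : ℤ) : Measurable fun s => phi s ^ n :=
  (continuous_phi.zpow₀ n fun s => Or.inl (phi_ne_zero s)).measurable

theorem norm_phi_zpow (n : ℤ) (s : ℝ) : ‖phi s ^ n‖ = 1 := by
  rw [norm_zpow, norm_phi, one_zpow]

/-- Multiplication by `φⁿ`. -/
def phiMul (n : ℤ) : L2R ≃ₗᵢ[ℂ] L2R := unimodMul (measurable_phi_zpow n) (norm_phi_zpow n)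

theorem coeFn_phiMul (n : ℤ) (f : L2R) :
    phiMul n f =ᵐ[volume] fun s => phi s ^ n * f s :=
  coeFn_unimodMul _ _ f

theorem phiMul_phiMul (m n : ℤ) (f : L2R) : phiMul m (phiMul n f) = phiMul (m + n) f := by
  apply Lp.ext
  filter_upwards [coeFn_phiMul m (phiMul n f), coeFn_phiMul n f, coeFn_phiMul (m + n) f]
    with s h1 h2 h3
  rw [h1, h2, h3, zpow_add₀ (phi_ne_zero s), mul_assoc]

theorem phiMul_zero (f : L2R) : phiMul 0 f = f := by
  apply Lp.ext
  filter_upwards [coeFn_phiMul 0 f] with s h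
  rw [h]; simp

/-! ### Uniqueness for the moments `∫ φⁿ h` -/

/-- The integrable functions all of whose moments against powers of `φ` vanish. -/
def HasZeroMoments (h : ℝ → ℂ) : Prop := Integrable h ∧ ∀ n : ℤ, ∫ s, phi s ^ n * h s = 0

theorem integrable_bdd_mul (a : BoundedContinuousFunction ℝ ℂ) {h : ℝ → ℂ} (hh : Integrable h) :
    Integrable fun s => a s * h s :=
  hh.bdd_mul (c := ‖a‖) a.continuous.aestronglyMeasurable (ae_of_all _ a.norm_coe_le_norm)

theorem integrable_phi_zpow_mul (n : ℤ) {h : ℝ → ℂ} (hh : Integrable h) :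
    Integrable fun s => phi s ^ n * h s :=
  hh.bdd_mul (c := 1) (measurable_phi_zpow n).aestronglyMeasurable
    (ae_of_all _ fun s => (norm_phi_zpow n s).le)

theorem HasZeroMoments.add {h k : ℝ → ℂ} (hh : HasZeroMoments h) (hk : HasZeroMoments k) :
    HasZeroMoments fun s => h s + k s := by
  refine ⟨hh.1.add hk.1, fun n => ?_⟩
  simp only [mul_add]
  rw [integral_add (integrable_phi_zpow_mul n hh.1) (integrable_phi_zpow_mul n hk.1),
    hh.2, hk.2, add_zero]

theorem HasZeroMoments.const_mul {h : ℝ → ℂ} (hh : HasZeroMoments h) (c : ℂ) :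
    HasZeroMoments fun s => c * h s := by
  refine ⟨hh.1.const_mul c, fun n => ?_⟩
  simp only [mul_left_comm _ c]
  rw [integral_const_mul, hh.2, mul_zero]

/-- On the line the conjugate of `φ` is `φ⁻¹`, so conjugation only exchanges the moments of index
`n` and `-n`. This is why all integer powers are required to annihilate `h`. -/
theorem HasZeroMoments.conj {h : ℝ → ℂ} (hh : HasZeroMoments h) :
    HasZeroMoments fun s => (starRingEnd ℂ) (h s) := by
  refine ⟨(RCLike.conjLIE.integrable_comp_iff (μ := volume)).2 hh.1, fun n => ?_⟩
  have h2 := congrArg (starRingEnd ℂ) (hh.2 (-n))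
  rw [← integral_conj, map_zero] at h2
  rw [← h2]
  refine integral_congr_ae (ae_of_all _ fun s => ?_)
  simp only [map_mul, map_zpow₀, conj_phi, inv_zpow', neg_neg]

theorem HasZeroMoments.phi_zpow_mul {h : ℝ → ℂ} (hh : HasZeroMoments h) (k : ℤ) :
    HasZeroMoments fun s => phi s ^ k * h s := by
  refine ⟨integrable_phi_zpow_mul k hh.1, fun n => ?_⟩
  simp only [← mul_assoc, ← zpow_add₀ (phi_ne_zero _)]
  exact hh.2 _

/-- The bounded continuous multipliers of the functions with vanishing moments. -/
def momentMultipliers : StarSubalgebra ℂ (BoundedContinuousFunction ℝ ℂ) where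
  carrier := {a | ∀ h, HasZeroMoments h → HasZeroMoments fun s => a s * h s}
  mul_mem' := fun {a b} ha hb h hh => by
    have := ha _ (hb h hh)
    simpa [mul_assoc] using this
  add_mem' := fun {a b} ha hb h hh => by
    have := (ha h hh).add (hb h hh)
    simpa [add_mul] using this
  algebraMap_mem' := fun c h hh => by
    simpa [Algebra.algebraMap_eq_smul_one] using hh.const_mul c
  -- Conjugate `h`, multiply by `a`, and conjugate back.
  star_mem' := fun {a} ha h hh => by
    have := (ha _ hh.conj).conj
    simpa using this

theorem integral_eq_zero_of_mem_momentMultipliers {a : BoundedContinuousFunction ℝ ℂ}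
    (ha : a ∈ momentMultipliers) {h : ℝ → ℂ} (hh : HasZeroMoments h) : ∫ s, a s * h s = 0 := by
  simpa using (ha h hh).2 0

/-- Multiplication by `φ` shifts the moments, so `φ` is itself a multiplier, and it is injective. -/
theorem separatesPoints_momentMultipliers :
    (momentMultipliers.map (BoundedContinuousFunction.toContinuousMapStarₐ ℂ)).SeparatesPoints := by
  intro s t hst
  let p : BoundedContinuousFunction ℝ ℂ :=
    BoundedContinuousFunction.ofNormedAddCommGroup phi continuous_phi 1 fun s => (norm_phi s).le
  refine ⟨phi, ?_, fun h => hst (phi_injective h)⟩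
  refine ⟨p.toContinuousMap, ⟨p, ?_, rfl⟩, rfl⟩
  intro h hh
  simpa [p] using hh.phi_zpow_mul 1

/-- The positive and negative parts of `h` are densities of two finite measures that agree on a
point-separating star algebra of bounded continuous functions. Such measures coincide, so the two
parts are equal a.e.; as at most one of them is nonzero at each point, `h` vanishes. -/
theorem HasZeroMoments.ae_eq_zero_of_real {h : ℝ → ℝ} (hh : HasZeroMoments fun s => (h s : ℂ)) :
    h =ᵐ[volume] 0 := by
  have hi : Integrable h := by simpa using hh.1.re
  have hp := hi.pos_part
  have hn := hi.neg_part
  let P := (volume : Measure ℝ).withDensity fun s => ENNReal.ofReal (max (h s) 0)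
  let Q := (volume : Measure ℝ).withDensity fun s => ENNReal.ofReal (max (-h s) 0)
  have fP : IsFiniteMeasure P := isFiniteMeasure_withDensity_ofReal hp.2
  have fQ : IsFiniteMeasure Q := isFiniteMeasure_withDensity_ofReal hn.2
  have key : P = Q := by
    apply ext_of_forall_mem_subalgebra_integral_eq_of_pseudoEMetric_complete_countable
      separatesPoints_momentMultipliers
    intro a ha
    have h0 := integral_eq_zero_of_mem_momentMultipliers ha hh
    rw [integral_withDensity_eq_integral_toReal_smul₀ hp.aestronglyMeasurable.aemeasurable.ennreal_ofReal (by simp),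
      integral_withDensity_eq_integral_toReal_smul₀ hn.aestronglyMeasurable.aemeasurable.ennreal_ofReal (by simp)]
    rw [← sub_eq_zero, ← integral_sub, ← h0]
    · refine integral_congr_ae (ae_of_all _ fun s => ?_)
      simp only [ENNReal.toReal_ofReal (le_max_right _ _)]
      rw [← sub_smul]
      have : max (h s) 0 - max (-h s) 0 = h s := by
        rcases le_total 0 (h s) with h1 | h1
        · rw [max_eq_left h1, max_eq_right (by linarith)]; ring
        · rw [max_eq_right h1, max_eq_left (by linarith)]; ring
      rw [this, mul_comm]; simp
    · refine (integrable_bdd_mul a hp.ofReal).congr (ae_of_all _ fun s => ?_)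
      simp only [ENNReal.toReal_ofReal (le_max_right _ _)]
      simp [mul_comm]
    · refine (integrable_bdd_mul a hn.ofReal).congr (ae_of_all _ fun s => ?_)
      simp only [ENNReal.toReal_ofReal (le_max_right _ _)]
      simp [mul_comm]
  have h2 := (withDensity_eq_iff hp.aestronglyMeasurable.aemeasurable.ennreal_ofReal
    hn.aestronglyMeasurable.aemeasurable.ennreal_ofReal
    (by exact (hasFiniteIntegral_iff_ofReal (ae_of_all _ fun s => le_max_right _ _)).1 hp.2 |>.ne)).1 key
  filter_upwards [h2] with s hs
  have h3 := congrArg ENNReal.toReal hs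
  rw [ENNReal.toReal_ofReal (le_max_right _ _), ENNReal.toReal_ofReal (le_max_right _ _)] at h3
  rcases le_total 0 (h s) with h1 | h1
  · rw [max_eq_left h1, max_eq_right (by linarith)] at h3; exact h3
  · rw [max_eq_right h1, max_eq_left (by linarith)] at h3; simp; linarith

theorem HasZeroMoments.ae_eq_zero {h : ℝ → ℂ} (hh : HasZeroMoments h) : h =ᵐ[volume] 0 := by
  have h1 : (fun s => (h s).re) =ᵐ[volume] 0 := by
    apply HasZeroMoments.ae_eq_zero_of_real
    have := (hh.add hh.conj).const_mul (1 / 2)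
    convert! this using 2 with s
    rw [Complex.add_conj]; push_cast; ring
  have h2 : (fun s => (h s).im) =ᵐ[volume] 0 := by
    apply HasZeroMoments.ae_eq_zero_of_real
    have := (hh.add (hh.conj.const_mul (-1))).const_mul (-Complex.I / 2)
    convert! this using 2 with s
    rw [neg_one_mul, ← sub_eq_add_neg, Complex.sub_conj]; push_cast
    linear_combination ((h s).im : ℂ) * Complex.I_mul_I
  filter_upwards [h1, h2] with s a b
  exact Complex.ext a b

/-! ### Invariant subspaces of multiplication by `φ` -/

theorem inner_phiMul (f g : L2R) (n : ℤ) :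
    inner ℂ f (phiMul n g) = ∫ s, phi s ^ n * inner ℂ (f s) (g s) := by
  rw [L2.inner_def]
  refine integral_congr_ae ?_
  filter_upwards [coeFn_phiMul n g] with s h
  rw [h]
  simp only [RCLike.inner_apply]
  ring

theorem inner_phiMul_left (f g : L2R) (n : ℤ) :
    inner ℂ (phiMul n f) g = inner ℂ f (phiMul (-n) g) := by
  rw [← (phiMul n).inner_map_map f, phiMul_phiMul, add_neg_cancel, phiMul_zero]

/-- The hypothesis says that all moments of the integrable function `s ↦ ⟨f s, g s⟩` vanish.
Orthogonality to a whole `φ`-orbit thus becomes disjointness of supports. -/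
theorem ae_eq_zero_of_inner_phiMul_eq_zero {f g : L2R}
    (h : ∀ n : ℤ, inner ℂ f (phiMul n g) = 0) : ∀ᵐ s, f s = 0 ∨ g s = 0 := by
  have h2 : HasZeroMoments fun s => inner ℂ (f s) (g s) :=
    ⟨L2.integrable_inner f g, fun n => by rw [← inner_phiMul, h]⟩
  filter_upwards [h2.ae_eq_zero] with s hs
  have hs' : g s * (starRingEnd ℂ) (f s) = 0 := hs
  simpa [or_comm] using hs'

theorem phiMul_mem_of_nat {N : Submodule ℂ L2R} (hN : ∀ f ∈ N, phiMul 1 f ∈ N) {f : L2R}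
    (hf : f ∈ N) (n : ℕ) : phiMul n f ∈ N := by
  induction n with
  | zero => simpa [phiMul_zero] using hf
  | succ n ih =>
    have := hN _ ih
    rwa [phiMul_phiMul, add_comm] at this

theorem norm_one_sub_phi_sq (s : ℝ) : ‖1 - phi s‖ ^ 2 = (1 / 4 + s ^ 2)⁻¹ := by
  rw [one_sub_phi, norm_div, norm_one, div_pow, one_pow, ← Complex.normSq_eq_norm_sq,
    Complex.normSq_apply, one_div]
  congr 1
  simp
  ring

theorem one_sub_phi_ne_zero (s : ℝ) : 1 - phi s ≠ 0 := by
  rw [one_sub_phi]; exact one_div_ne_zero (half_sub_ne_zero s)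

theorem integrable_norm_one_sub_phi_sq : Integrable fun s => ‖1 - phi s‖ ^ 2 := by
  refine (integrable_inv_one_add_sq.const_mul 4).mono'
    (((continuous_const.sub continuous_phi).norm.pow 2).aestronglyMeasurable)
    (ae_of_all _ fun s => ?_)
  rw [Real.norm_of_nonneg (by positivity), norm_one_sub_phi_sq, ← div_eq_mul_inv,
    le_div_iff₀ (by positivity), inv_mul_le_iff₀ (by positivity)]
  nlinarith [sq_nonneg s]

theorem memLp_one_sub_phi : MemLp (fun s => 1 - phi s) 2 (volume : Measure ℝ) :=
  (memLp_two_iff_integrable_sq_norm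
    (continuous_const.sub continuous_phi).aestronglyMeasurable).2 integrable_norm_one_sub_phi_sq

/-- `N` is a spectral subspace as soon as it reduces multiplication by `φ`. -/
theorem exists_eq_indicatorL2 {N : Submodule ℂ L2R} (hc : IsClosed (N : Set L2R))
    (hN : ∀ (n : ℤ), ∀ f ∈ N, phiMul n f ∈ N) :
    ∃ A : Set ℝ, MeasurableSet A ∧ N = indicatorL2 A := by
  have : CompleteSpace N := hc.completeSpace_coe
  -- Any nowhere vanishing vector of `L²` would serve here. The support of its projection `p` to `N`
  -- is the required set.
  let e : L2R := memLp_one_sub_phi.toLp _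
  have he : ∀ᵐ s, e s ≠ 0 := by
    filter_upwards [memLp_one_sub_phi.coeFn_toLp] with s h
    rw [h]; exact one_sub_phi_ne_zero s
  let p : L2R := N.starProjection e
  have hp : p ∈ N := N.starProjection_apply_mem e
  have hd : e - p ∈ Nᗮ := N.sub_starProjection_mem_orthogonal e
  have h1 : ∀ g ∈ N, ∀ᵐ s, e s = p s ∨ g s = 0 := by
    intro g hg
    have := ae_eq_zero_of_inner_phiMul_eq_zero (f := e - p) (g := g) fun n =>
      Submodule.inner_left_of_mem_orthogonal (hN n g hg) hd
    filter_upwards [this, Lp.coeFn_sub e p] with s h1 h2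
    rw [h2, Pi.sub_apply, sub_eq_zero] at h1
    exact h1
  refine ⟨{s | p s ≠ 0}, (Lp.stronglyMeasurable p).measurable
    (measurableSet_singleton (0 : ℂ)).compl, le_antisymm ?_ ?_⟩
  -- Where `p = 0`, the nonzero `e` differs from `p`, and `g` vanishes there.
  · intro g hg
    refine ⟨g, trivial, ?_⟩
    filter_upwards [h1 g hg, he] with s h2 h3
    by_cases h4 : p s = 0
    · rw [h4] at h2
      simp [h4, h2.resolve_left h3]
    · simp [h4]
  -- The residual `r` vanishes on the support of `p` since `r` is orthogonal to the orbit of `p`.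
  -- Off that support both `g` and its projection vanish.
  · rintro g ⟨g', -, hg⟩
    let r := g - N.starProjection g
    have hr : r ∈ Nᗮ := N.sub_starProjection_mem_orthogonal g
    have h2 := ae_eq_zero_of_inner_phiMul_eq_zero (f := r) (g := p) fun n =>
      Submodule.inner_left_of_mem_orthogonal (hN n p hp) hr
    have h3 : r = 0 := by
      apply Lp.ext
      filter_upwards [h2, hg, Lp.coeFn_sub g (N.starProjection g), he,
        h1 _ (N.starProjection_apply_mem g), Lp.coeFn_zero ℂ 2 (volume : Measure ℝ)]
        with s a b c d e' z
      rw [z]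
      by_cases h4 : p s = 0
      · rw [h4] at e'
        have := e'.resolve_left d
        rw [c, Pi.sub_apply, this, b]
        simp [h4]
      · exact a.resolve_right h4
    rw [sub_eq_zero.1 h3]
    exact N.starProjection_apply_mem g

/-! ### Moments of `|1 - φ|²` and wandering vectors. -/

theorem hasDerivAt_phi_zpow (n : ℤ) (s : ℝ) :
    HasDerivAt (fun s => phi s ^ n) (Complex.I * n * (phi s ^ n * (‖1 - phi s‖ ^ 2 : ℝ))) s := by
  have h0 := half_sub_ne_zero s
  have hp := phi_ne_zero s
  have h1 : HasDerivAt (fun s : ℝ => (1 / 2 - Complex.I * s : ℂ)) (-Complex.I) s := by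
    have := ((Complex.ofRealCLM.hasDerivAt (x := s)).const_mul Complex.I).const_sub (1 / 2)
    simpa only [Complex.ofRealCLM_apply, Complex.ofReal_one, mul_one] using this
  have h2 : HasDerivAt phi (-(Complex.I * (1 - phi s) ^ 2)) s := by
    have h3 := (h1.inv h0).const_sub 1
    have h4 : phi = fun s : ℝ => 1 - (1 / 2 - Complex.I * s : ℂ)⁻¹ := by
      funext t; rw [← one_div, ← one_sub_phi]; ring
    rw [one_sub_phi]
    rw [h4]
    refine h3.congr_deriv ?_
    rw [neg_neg, one_div_pow, mul_one_div]
  -- This uses that the conjugate of `φ` is `φ⁻¹`; it turns `-(1 - φ)² / φ` into `|1 - φ|²`.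
  have h5 : ((‖1 - phi s‖ ^ 2 : ℝ) : ℂ) = (1 - phi s) * (1 - (phi s)⁻¹) := by
    rw [← conj_phi, ← map_one (starRingEnd ℂ), ← map_sub, map_one, Complex.mul_conj,
      Complex.normSq_eq_norm_sq]
  have h6 := (hasDerivAt_zpow n (phi s) (Or.inl hp)).comp s h2
  refine h6.congr_deriv ?_
  rw [h5, zpow_sub_one₀ hp]
  field_simp
  ring

theorem tendsto_one_sub_phi {l : Filter ℝ} (hl : Filter.Tendsto (fun s : ℝ => |s|) l Filter.atTop) :
    Filter.Tendsto phi l (nhds 1) := by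
  have h : Filter.Tendsto (fun s => ‖1 - phi s‖ ^ 2) l (nhds 0) := by
    simp only [norm_one_sub_phi_sq]
    apply Filter.Tendsto.inv_tendsto_atTop
    apply Filter.tendsto_atTop_add_const_left
    exact ((Filter.tendsto_pow_atTop two_ne_zero).comp hl).congr fun s => sq_abs s
  have h2 := h.sqrt
  simp only [Real.sqrt_sq (norm_nonneg _), Real.sqrt_zero] at h2
  have h3 := (tendsto_zero_iff_norm_tendsto_zero.2 h2).const_sub 1
  simpa using h3

/-- Up to the factor `i n` the integrand is the derivative of `φⁿ`, which has the same limit `1` at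
both ends of the line. -/
theorem integral_phi_zpow_mul_norm_sq {n : ℤ} (hn : n ≠ 0) :
    ∫ s, phi s ^ n * (‖1 - phi s‖ ^ 2 : ℝ) = 0 := by
  have hi := (integrable_phi_zpow_mul n integrable_norm_one_sub_phi_sq.ofReal).const_mul
    (Complex.I * n)
  have ht : ∀ {l : Filter ℝ}, Filter.Tendsto (fun s : ℝ => |s|) l Filter.atTop →
      Filter.Tendsto (fun s => phi s ^ n) l (nhds (1 ^ n)) := fun hl =>
    (tendsto_one_sub_phi hl).zpow₀ n (Or.inl one_ne_zero)
  have h := integral_of_hasDerivAt_of_tendsto (hasDerivAt_phi_zpow n) hi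
    (ht Filter.tendsto_abs_atBot_atTop) (ht Filter.tendsto_abs_atTop_atTop)
  rw [sub_self, integral_const_mul] at h
  exact (mul_eq_zero.1 h).resolve_left
    (mul_ne_zero Complex.I_ne_zero (Int.cast_ne_zero.2 hn))

/-- A unit vector of `N` orthogonal to `φ N`. -/
structure IsWandering (N : Submodule ℂ L2R) (ψ : L2R) : Prop where
  mem : ψ ∈ N
  norm_eq_one : ‖ψ‖ = 1
  inner_eq_zero : ∀ f ∈ N, inner ℂ (phiMul 1 f) ψ = 0

/-- The subspace `K` in the proof is `φ N`, closed and contained in `N`. The vector `g` lies in `N`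
but outside `K`, so its component orthogonal to `K` is nonzero and can be normalized. -/
theorem exists_isWandering {N : Submodule ℂ L2R} (hc : IsClosed (N : Set L2R))
    (hN : ∀ f ∈ N, phiMul 1 f ∈ N) {g : L2R} (hg : g ∈ N) (hg' : phiMul (-1) g ∉ N) :
    ∃ ψ, IsWandering N ψ := by
  let K : Submodule ℂ L2R := N.comap (phiMul (-1)).toLinearEquiv.toLinearMap
  have hK : IsClosed (K : Set L2R) := hc.preimage (phiMul (-1)).continuous
  have : CompleteSpace K := hK.completeSpace_coe
  have hKN : K ≤ N := fun f hf => by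
    have := hN _ (show phiMul (-1) f ∈ N from hf)
    rwa [phiMul_phiMul, add_neg_cancel, phiMul_zero] at this
  let r := g - K.starProjection g
  have hr : r ∈ Kᗮ := K.sub_starProjection_mem_orthogonal g
  have hr0 : r ≠ 0 := fun h => hg' (by
    have : g ∈ K := by
      rw [sub_eq_zero.1 h]; exact K.starProjection_apply_mem g
    exact this)
  have hrN : r ∈ N := N.sub_mem hg (hKN (K.starProjection_apply_mem g))
  refine ⟨((‖r‖⁻¹ : ℝ) : ℂ) • r, N.smul_mem _ hrN, ?_, fun f hf => ?_⟩
  · rw [norm_smul, Complex.norm_real, norm_inv, norm_norm,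
      inv_mul_cancel₀ (norm_ne_zero_iff.2 hr0)]
  · rw [inner_smul_right, Submodule.inner_right_of_mem_orthogonal (K := K) _ hr, mul_zero]
    change phiMul (-1) (phiMul 1 f) ∈ N
    rwa [phiMul_phiMul, neg_add_cancel, phiMul_zero]

namespace IsWandering

variable {N : Submodule ℂ L2R} {ψ : L2R}

theorem inner_phiMul_succ (h : IsWandering N ψ) (hN : ∀ f ∈ N, phiMul 1 f ∈ N) {f : L2R}
    (hf : f ∈ N) (n : ℕ) : inner ℂ (phiMul (n + 1) f) ψ = 0 := by
  have := h.inner_eq_zero _ (phiMul_mem_of_nat hN hf n)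
  rwa [phiMul_phiMul, add_comm] at this

theorem inner_phiMul_self (h : IsWandering N ψ) (hN : ∀ f ∈ N, phiMul 1 f ∈ N) {n : ℤ}
    (hn : n ≠ 0) : inner ℂ ψ (phiMul n ψ) = 0 := by
  obtain ⟨k, rfl | rfl⟩ : ∃ k : ℕ, n = k + 1 ∨ n = -(k + 1) := by
    rcases lt_or_gt_of_ne hn with h | h
    · exact ⟨(-n - 1).toNat, Or.inr (by omega)⟩
    · exact ⟨(n - 1).toNat, Or.inl (by omega)⟩
  · rw [← inner_conj_symm, h.inner_phiMul_succ hN h.mem, map_zero]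
  · rw [← inner_phiMul_left, h.inner_phiMul_succ hN h.mem]

/-- Both sides have the same moments: zero for `n ≠ 0`, and `K` for `n = 0` because `ψ` is a unit
vector. The constant `K` need not be evaluated, only shared by all wandering vectors. -/
theorem norm_sq_ae_eq (h : IsWandering N ψ) (hN : ∀ f ∈ N, phiMul 1 f ∈ N) :
    ∀ᵐ s, (∫ t, ‖1 - phi t‖ ^ 2) * ‖ψ s‖ ^ 2 = ‖1 - phi s‖ ^ 2 := by
  set K := ∫ t, ‖1 - phi t‖ ^ 2 with hK
  have hi := L2.integrable_inner (𝕜 := ℂ) ψ ψ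
  have hk : Integrable fun s => ((‖1 - phi s‖ ^ 2 : ℝ) : ℂ) :=
    integrable_norm_one_sub_phi_sq.ofReal
  have hz : HasZeroMoments fun s =>
      (K : ℂ) * inner ℂ (ψ s) (ψ s) - ((‖1 - phi s‖ ^ 2 : ℝ) : ℂ) := by
    refine ⟨(hi.const_mul _).sub hk, fun n => ?_⟩
    simp only [mul_sub, mul_left_comm _ (K : ℂ)]
    rw [integral_sub ((integrable_phi_zpow_mul n hi).const_mul _) (integrable_phi_zpow_mul n hk),
      integral_const_mul, ← inner_phiMul]
    by_cases hn : n = 0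
    · subst hn
      rw [phiMul_zero, inner_self_eq_norm_sq_to_K, h.norm_eq_one]
      simp only [zpow_zero, one_mul]
      rw [show (∫ s, ((‖1 - phi s‖ ^ 2 : ℝ) : ℂ)) = (K : ℂ) from integral_ofReal]
      simp
    · rw [h.inner_phiMul_self hN hn]
      have := integral_phi_zpow_mul_norm_sq hn
      simp only [this]; simp
  filter_upwards [hz.ae_eq_zero] with s hs
  have hs' : (K : ℂ) * inner ℂ (ψ s) (ψ s) - ((‖1 - phi s‖ ^ 2 : ℝ) : ℂ) = 0 := hs
  have hψ : inner ℂ (ψ s) (ψ s) = ((‖ψ s‖ ^ 2 : ℝ) : ℂ) := by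
    rw [inner_self_eq_norm_sq_to_K]; simp
  rw [hψ, sub_eq_zero] at hs'
  exact_mod_cast hs'

theorem ae_ne_zero (h : IsWandering N ψ) (hN : ∀ f ∈ N, phiMul 1 f ∈ N) : ∀ᵐ s, ψ s ≠ 0 := by
  filter_upwards [h.norm_sq_ae_eq hN] with s hs h0
  rw [h0] at hs
  have := norm_pos_iff.2 (one_sub_phi_ne_zero s)
  have : 0 < ‖1 - phi s‖ ^ 2 := by positivity
  simp at hs
  simp [← hs] at this

theorem norm_ae_eq (h : IsWandering N ψ) (hN : ∀ f ∈ N, phiMul 1 f ∈ N)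
    {N' : Submodule ℂ L2R} {ψ' : L2R} (h' : IsWandering N' ψ')
    (hN' : ∀ f ∈ N', phiMul 1 f ∈ N') : ∀ᵐ s, ‖ψ s‖ = ‖ψ' s‖ := by
  filter_upwards [h.norm_sq_ae_eq hN, h'.norm_sq_ae_eq hN'] with s a b
  have hp := norm_pos_iff.2 (one_sub_phi_ne_zero s)
  have hp2 : 0 < ‖1 - phi s‖ ^ 2 := by positivity
  have hK : (∫ t, ‖1 - phi t‖ ^ 2) ≠ 0 := fun h0 => by
    rw [h0, zero_mul] at a; exact hp2.ne a
  have := mul_left_cancel₀ hK (a.trans b.symm)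
  exact (sq_eq_sq₀ (norm_nonneg _) (norm_nonneg _)).1 this

/-- Project `g ∈ N` to `N ⊓ N'`. The residual `r` is orthogonal to `φᵏ ψ` for `k ≥ 0`, since these
lie in the intersection. It is orthogonal to the negative powers because `r` is still in `N`, whence
`φᵏ⁺¹ r` is orthogonal to `ψ`. As `ψ` vanishes almost nowhere, `r = 0`. -/
theorem le_of_mem (h : IsWandering N ψ) (hc : IsClosed (N : Set L2R))
    (hN : ∀ f ∈ N, phiMul 1 f ∈ N) {N' : Submodule ℂ L2R} (hc' : IsClosed (N' : Set L2R))
    (hN' : ∀ f ∈ N', phiMul 1 f ∈ N') (hψ : ψ ∈ N') : N ≤ N' := by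
  intro g hg
  let K := N ⊓ N'
  have hK : IsClosed (K : Set L2R) := hc.inter hc'
  have : CompleteSpace K := hK.completeSpace_coe
  let r := g - K.starProjection g
  have hr : r ∈ Kᗮ := K.sub_starProjection_mem_orthogonal g
  have hPK : K.starProjection g ∈ K := K.starProjection_apply_mem g
  have hrN : r ∈ N := N.sub_mem hg hPK.1
  have h1 := ae_eq_zero_of_inner_phiMul_eq_zero (f := r) (g := ψ) fun n => by
    obtain ⟨k, rfl | rfl⟩ : ∃ k : ℕ, n = k ∨ n = -(k + 1) := by
      rcases lt_or_ge n 0 with h | h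
      · exact ⟨(-n - 1).toNat, Or.inr (by omega)⟩
      · exact ⟨n.toNat, Or.inl (by omega)⟩
    · exact Submodule.inner_left_of_mem_orthogonal (K := K)
        ⟨phiMul_mem_of_nat hN h.mem k, phiMul_mem_of_nat hN' hψ k⟩ hr
    · rw [← inner_phiMul_left]
      exact h.inner_phiMul_succ hN hrN k
  have h2 : r = 0 := by
    apply Lp.ext
    filter_upwards [h1, h.ae_ne_zero hN, Lp.coeFn_zero ℂ 2 (volume : Measure ℝ)] with s a b z
    rw [z]; exact a.resolve_right b
  rw [sub_eq_zero.1 h2]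
  exact hPK.2

end IsWandering

/-! ### Comparison of two simply invariant subspaces. -/

theorem mem_mulSubspace_iff {q : ℝ → ℂ} (hq : Measurable q) (h1 : ∀ x, ‖q x‖ = 1)
    (N : Submodule ℂ L2R) (f : L2R) :
    f ∈ mulSubspace q N ↔ (unimodMul hq h1).symm f ∈ N := by
  constructor
  · rintro ⟨g, hg, h⟩
    have : f = unimodMul hq h1 g := Lp.ext (h.trans (coeFn_unimodMul hq h1 g).symm)
    rwa [this, LinearIsometryEquiv.symm_apply_apply]
  · intro h
    refine ⟨_, h, ?_⟩
    have := coeFn_unimodMul hq h1 ((unimodMul hq h1).symm f)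
    rwa [LinearIsometryEquiv.apply_symm_apply] at this

theorem unimodMul_phiMul {q : ℝ → ℂ} (hq : Measurable q) (h1 : ∀ x, ‖q x‖ = 1) (n : ℤ)
    (f : L2R) : unimodMul hq h1 (phiMul n f) = phiMul n (unimodMul hq h1 f) := by
  apply Lp.ext
  filter_upwards [coeFn_unimodMul hq h1 (phiMul n f), coeFn_phiMul n f,
    coeFn_phiMul n (unimodMul hq h1 f), coeFn_unimodMul hq h1 f] with s a b c d
  rw [a, b, c, d, mul_left_comm]

theorem phiMul_mem_mulSubspace {q : ℝ → ℂ} (hq : Measurable q) (h1 : ∀ x, ‖q x‖ = 1)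
    {N : Submodule ℂ L2R} (hN : ∀ f ∈ N, phiMul 1 f ∈ N) :
    ∀ f ∈ mulSubspace q N, phiMul 1 f ∈ mulSubspace q N := by
  intro f hf
  rw [mem_mulSubspace_iff hq h1] at hf ⊢
  convert hN _ hf using 1
  rw [LinearIsometryEquiv.symm_apply_eq, unimodMul_phiMul, LinearIsometryEquiv.apply_symm_apply]

theorem exists_eq_mulSubspace {N₁ N₂ : Submodule ℂ L2R} (hc₁ : IsClosed (N₁ : Set L2R))
    (hc₂ : IsClosed (N₂ : Set L2R)) (hN₁ : ∀ f ∈ N₁, phiMul 1 f ∈ N₁)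
    (hN₂ : ∀ f ∈ N₂, phiMul 1 f ∈ N₂) {g₁ g₂ : L2R} (hg₁ : g₁ ∈ N₁) (hg₂ : g₂ ∈ N₂)
    (hg₁' : phiMul (-1) g₁ ∉ N₁) (hg₂' : phiMul (-1) g₂ ∉ N₂) :
    ∃ q : ℝ → ℂ, Measurable q ∧ (∀ x, ‖q x‖ = 1) ∧ N₁ = mulSubspace q N₂ := by
  classical
  obtain ⟨ψ₁, h₁⟩ := exists_isWandering hc₁ hN₁ hg₁ hg₁'
  obtain ⟨ψ₂, h₂⟩ := exists_isWandering hc₂ hN₂ hg₂ hg₂'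
  have hm : Measurable fun s => ψ₁ s / ψ₂ s :=
    (Lp.stronglyMeasurable ψ₁).measurable.div (Lp.stronglyMeasurable ψ₂).measurable
  -- The quotient is unimodular only almost everywhere; the value `1` on the exceptional null set
  -- makes `q` unimodular everywhere.
  let q : ℝ → ℂ := fun s => if ‖ψ₁ s / ψ₂ s‖ = 1 then ψ₁ s / ψ₂ s else 1
  have hq : Measurable q :=
    Measurable.ite (hm.norm (measurableSet_singleton 1)) hm measurable_const
  have hq1 : ∀ s, ‖q s‖ = 1 := fun s => by
    by_cases h : ‖ψ₁ s / ψ₂ s‖ = 1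
    · simp only [q, if_pos h, h]
    · simp only [q, if_neg h, norm_one]
  have hψ : unimodMul hq hq1 ψ₂ = ψ₁ := by
    apply Lp.ext
    filter_upwards [coeFn_unimodMul hq hq1 ψ₂, h₁.norm_ae_eq hN₁ h₂ hN₂, h₂.ae_ne_zero hN₂]
      with s a b c
    have : ‖ψ₁ s / ψ₂ s‖ = 1 := by
      rw [norm_div, b, div_self (norm_ne_zero_iff.2 c)]
    rw [a]
    simp only [q, if_pos this]
    exact div_mul_cancel₀ _ c
  -- Both inclusions come from minimality: `q N₂` contains `ψ₁ = q ψ₂`, and `q⁻¹ N₁` contains `ψ₂`.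
  refine ⟨q, hq, hq1, le_antisymm ?_ ?_⟩
  · refine h₁.le_of_mem hc₁ hN₁ ?_ (phiMul_mem_mulSubspace hq hq1 hN₂) ?_
    · have : (mulSubspace q N₂ : Set L2R) = (unimodMul hq hq1).symm ⁻¹' N₂ := by
        ext f; exact mem_mulSubspace_iff hq hq1 N₂ f
      rw [this]
      exact hc₂.preimage (unimodMul hq hq1).symm.continuous
    · rw [mem_mulSubspace_iff hq hq1, ← hψ, LinearIsometryEquiv.symm_apply_apply]
      exact h₂.mem
  · let K : Submodule ℂ L2R := N₁.comap (unimodMul hq hq1).toLinearEquiv.toLinearMap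
    have hK : N₂ ≤ K := by
      refine h₂.le_of_mem hc₂ hN₂ (hc₁.preimage (unimodMul hq hq1).continuous) ?_ ?_
      · intro f hf
        change unimodMul hq hq1 (phiMul 1 f) ∈ N₁
        rw [unimodMul_phiMul]
        exact hN₁ _ hf
      · change unimodMul hq hq1 ψ₂ ∈ N₁
        rw [hψ]; exact h₁.mem
    intro f hf
    have : unimodMul hq hq1 ((unimodMul hq hq1).symm f) ∈ N₁ :=
      hK ((mem_mulSubspace_iff hq hq1 N₂ f).1 hf)
    rwa [LinearIsometryEquiv.apply_symm_apply] at this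

/-! ### The Cesàro operator on the Fourier side -/

/-- Since the weight never vanishes, null sets correspond in both directions, whereas `qmp` gives
only one. The converse direction is what permits pointwise formulas for `Φ⁻¹`. -/
theorem IsChangeOfVariables.ae_iff {μ ν : Measure ℝ} {w : ℝ → ℂ} {τ σ : ℝ → ℝ}
    (h : IsChangeOfVariables μ ν w τ σ) {p : ℝ → Prop} (hp : MeasurableSet {x | p x}) :
    (∀ᵐ x ∂μ, p x) ↔ ∀ᵐ u ∂ν, p (τ u) := by
  have h1 := h.lintegral_eq ({x | p x}ᶜ.indicator 1)
  have hm : Measurable fun u => ‖w u‖ₑ ^ 2 * {x | p x}ᶜ.indicator (1 : ℝ → ℝ≥0∞) (τ u) :=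
    (h.measurable_w.enorm.pow_const 2).mul ((measurable_one.indicator hp.compl).comp h.measurable_τ)
  rw [lintegral_indicator_one hp.compl] at h1
  rw [MeasureTheory.ae_iff, show {x | ¬ p x} = {x | p x}ᶜ from rfl, h1, lintegral_eq_zero_iff hm]
  refine Filter.eventually_congr (ae_of_all _ fun u => ?_)
  by_cases hu : p (τ u)
  · simp [hu]
  · simp [hu, h.w_ne_zero u]

theorem weight_log {x : ℝ} (hx : x ∈ Ioo (0 : ℝ) 1) :
    Real.exp (Real.log ((1 - x) / x) / 2) / (1 + Real.exp (Real.log ((1 - x) / x))) =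
      √((1 - x) / x) * x := by
  have h0 := hx.1
  have h1 : 0 < 1 - x := by linarith [hx.2]
  rw [Real.exp_half, Real.exp_log (by positivity)]
  field_simp
  ring

theorem coeFn_Phi_symm (g : SchwartzMap ℝ ℂ) :
    Phi.symm (g.toLp 2) =ᵐ[volume.restrict (Ioo (0 : ℝ) 1)] fun x : ℝ =>
      g (Real.log ((1 - x) / x)) / ((√((1 - x) / x) * x : ℝ) : ℂ) := by
  have hc := isChangeOfVariables_logistic
  set k := Phi.symm (g.toLp 2) with hk
  have h1 : Phi k =ᵐ[volume] g := by
    rw [hk, LinearIsometryEquiv.apply_symm_apply]; exact g.coeFn_toLp 2 volume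
  have h2 : ∀ᵐ x ∂(volume.restrict (Ioo (0 : ℝ) 1)), k x = g (Real.log ((1 - x) / x)) /
      ((Real.exp (Real.log ((1 - x) / x) / 2) /
        (1 + Real.exp (Real.log ((1 - x) / x))) : ℝ) : ℂ) := by
    rw [hc.ae_iff]
    · filter_upwards [h1, coeFn_Phi k] with u a b
      have hl := hc.left_inv u
      rw [show Real.log ((1 - 1 / (1 + Real.exp u)) / (1 / (1 + Real.exp u))) = u from hl, ← a, b, mul_div_cancel_left₀]
      exact hc.w_ne_zero u
    · refine measurableSet_eq_fun (Lp.stronglyMeasurable k).measurable ?_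
      exact (g.continuous.measurable.comp (by fun_prop)).div (by fun_prop)
  filter_upwards [h2, ae_restrict_mem measurableSet_Ioo] with x a hx
  rw [a, weight_log hx]

/-- The function differentiated is `t ↦ t (Φ⁻¹ G)(t)`, and its derivative is `Φ⁻¹(G / 2 - G')(t) /
(1 - t)`, the integrand in the Cesàro operator. -/
theorem hasDerivAt_sqrt_mul_log (G : SchwartzMap ℝ ℂ) {t : ℝ} (ht : t ∈ Ioo (0 : ℝ) 1) :
    HasDerivAt (fun t : ℝ => ((√(t / (1 - t)) : ℝ) : ℂ) * G (Real.log ((1 - t) / t)))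
      (((1 / 2 : ℂ) * G (Real.log ((1 - t) / t)) - deriv G (Real.log ((1 - t) / t))) /
        ((√((1 - t) / t) * t : ℝ) : ℂ) / (1 - (t : ℂ))) t := by
  have a : 0 < t := ht.1
  have b : 0 < 1 - t := by linarith [ht.2]
  have e1 : HasDerivAt (fun t : ℝ => t / (1 - t)) (1 / (1 - t) ^ 2) t := by
    have := (hasDerivAt_id t).div ((hasDerivAt_id t).const_sub 1) b.ne'
    convert! this using 1
    simp
  have e2 : HasDerivAt (fun t : ℝ => (1 - t) / t) (-(1 / t ^ 2)) t := by
    have := ((hasDerivAt_id t).const_sub 1).div (hasDerivAt_id t) a.ne'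
    convert! this using 1
    simp
    field_simp
    ring
  have e3 := (e1.sqrt (by positivity)).ofReal_comp
  have e4 := e2.log (by positivity)
  have e5 := (G.hasDerivAt (Real.log ((1 - t) / t))).scomp t e4
  refine (e3.mul e5).congr_deriv ?_
  have hs : 0 < √(t / (1 - t)) := Real.sqrt_pos.2 (by positivity)
  rw [show (1 - t) / t = (t / (1 - t))⁻¹ by simp, Real.sqrt_inv]
  have hsq : √(t / (1 - t)) ^ 2 * (1 - t) = t := by
    rw [Real.sq_sqrt (by positivity)]; field_simp
  have ha : (t : ℂ) ≠ 0 := by exact_mod_cast a.ne'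
  have hb : (1 - (t : ℂ)) ≠ 0 := by exact_mod_cast b.ne'
  have hs' : ((√(t / (1 - t)) : ℝ) : ℂ) ≠ 0 := by exact_mod_cast hs.ne'
  have hsq' : ((√(t / (1 - t)) : ℝ) : ℂ) ^ 2 * (1 - t) = t := by exact_mod_cast hsq
  generalize √(t / (1 - t)) = r at *
  simp only [Function.comp_apply, Complex.real_smul]
  push_cast
  field_simp
  linear_combination (-G (Real.log ((1 - t) / t))) * hsq'

theorem cesaro_Phi_symm (G H : SchwartzMap ℝ ℂ) (hGH : ∀ u, H u = (1 / 2 : ℂ) * G u - deriv G u) :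
    cesaro (Phi.symm (H.toLp 2)) = Phi.symm (G.toLp 2) := by
  apply Lp.ext
  filter_upwards [coeFn_cesaro (Phi.symm (H.toLp 2)), coeFn_Phi_symm G,
    ae_restrict_mem measurableSet_Ioo] with x h1 h2 hx
  rw [h1, h2, cesaroFun]
  have a : 0 < x := hx.1
  have b : 0 < 1 - x := by linarith [hx.2]
  let P : ℝ → ℂ := fun t => ((√(t / (1 - t)) : ℝ) : ℂ) * G (Real.log ((1 - t) / t))
  let p : ℝ → ℂ := fun t => ((1 / 2 : ℂ) * G (Real.log ((1 - t) / t)) -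
    deriv G (Real.log ((1 - t) / t))) / ((√((1 - t) / t) * t : ℝ) : ℂ) / (1 - (t : ℂ))
  have hae : ∀ᵐ t ∂(volume.restrict (Ioc 0 x)),
      Phi.symm (H.toLp 2) t / (1 - (t : ℂ)) = p t := by
    have := ae_restrict_of_ae_restrict_of_subset
      (show Ioc 0 x ⊆ Ioo (0 : ℝ) 1 from fun t ht => ⟨ht.1, ht.2.trans_lt hx.2⟩) (coeFn_Phi_symm H)
    filter_upwards [this] with t ht
    rw [ht, hGH]
  have hi : IntervalIntegrable p volume 0 x := by
    have := intervalIntegrable_cesaro (Phi.symm (H.toLp 2)) hx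
    rw [intervalIntegrable_iff_integrableOn_Ioc_of_le a.le] at this ⊢
    exact this.congr hae
  have hP0 : P 0 = 0 := by simp [P]
  have hcont : ContinuousOn P (Icc 0 x) := by
    intro t ht
    rcases ht.1.eq_or_lt with h0 | h0
    · subst h0
      rw [ContinuousWithinAt, hP0, tendsto_zero_iff_norm_tendsto_zero]
      -- At `0` the logarithm blows up, but `G` is bounded and the square root tends to zero.
      obtain ⟨C, hC⟩ : ∃ C, ∀ u, ‖G u‖ ≤ C := ⟨_, fun u => G.norm_le_seminorm ℂ u⟩
      have hlim : Filter.Tendsto (fun t : ℝ => √(t / (1 - t)) * C) (nhdsWithin 0 (Icc 0 x))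
          (nhds 0) := by
        have : ContinuousAt (fun t : ℝ => √(t / (1 - t)) * C) 0 := by
          refine ContinuousAt.mul ?_ continuousAt_const
          exact (ContinuousAt.div continuousAt_id (by fun_prop) (by norm_num)).sqrt
        have h := this.tendsto
        simp only [zero_div, Real.sqrt_zero, zero_mul] at h
        exact h.mono_left nhdsWithin_le_nhds
      refine squeeze_zero (fun t => norm_nonneg _) (fun t => ?_) hlim
      rw [norm_mul, Complex.norm_real, Real.norm_of_nonneg (Real.sqrt_nonneg _)]
      exact mul_le_mul_of_nonneg_left (hC _) (Real.sqrt_nonneg _)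
    · exact (hasDerivAt_sqrt_mul_log G ⟨h0, ht.2.trans_lt hx.2⟩).continuousAt.continuousWithinAt
  have hint : ∫ t in (0 : ℝ)..x, Phi.symm (H.toLp 2) t / (1 - (t : ℂ)) = P x := by
    rw [intervalIntegral.integral_of_le a.le, integral_congr_ae hae,
      ← intervalIntegral.integral_of_le a.le,
      intervalIntegral.integral_eq_sub_of_hasDerivAt_of_le a.le hcont
        (fun t ht => hasDerivAt_sqrt_mul_log G ⟨ht.1, ht.2.trans hx.2⟩) hi, hP0, sub_zero]
  rw [hint]
  simp only [P]
  have hs : 0 < √(x / (1 - x)) := Real.sqrt_pos.2 (by positivity)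
  rw [show (1 - x) / x = (x / (1 - x))⁻¹ by simp, Real.sqrt_inv]
  have ha : (x : ℂ) ≠ 0 := by exact_mod_cast a.ne'
  have hs' : ((√(x / (1 - x)) : ℝ) : ℂ) ≠ 0 := by exact_mod_cast hs.ne'
  push_cast
  field_simp

/-! ### The intertwining of `1 - C` with multiplication by `φ`. -/

theorem coeFn_fourierL2 (g : SchwartzMap ℝ ℂ) :
    fourierL2 (g.toLp 2) =ᵐ[volume] fun s : ℝ =>
      (((√(2 * Real.pi))⁻¹ : ℝ) : ℂ) * 𝓕 g (s / (2 * Real.pi)) := by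
  have h1 : fourierL2 (g.toLp 2) =
      isChangeOfVariables_dilation.toEquiv ((𝓕 g).toLp 2) := by
    rw [← SchwartzMap.toLp_fourier_eq]; rfl
  rw [h1]
  exact (isChangeOfVariables_dilation.coeFn_toEquiv _).trans
    (isChangeOfVariables_dilation.congr ((𝓕 g).coeFn_toLp 2 volume))

/-- The first order differential operator `G ↦ G / 2 - G'`. -/
def halfSubDeriv (G : SchwartzMap ℝ ℂ) : SchwartzMap ℝ ℂ :=
  (1 / 2 : ℂ) • G - SchwartzMap.derivCLM ℂ ℂ G

theorem halfSubDeriv_apply (G : SchwartzMap ℝ ℂ) (u : ℝ) :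
    halfSubDeriv G u = (1 / 2 : ℂ) * G u - deriv G u := by
  simp [halfSubDeriv]

theorem fourier_halfSubDeriv (G : SchwartzMap ℝ ℂ) (ξ : ℝ) :
    𝓕 (halfSubDeriv G) ξ = (1 / 2 - Complex.I * (ξ * (2 * Real.pi) : ℝ)) * 𝓕 G ξ := by
  have h1 : 𝓕 (SchwartzMap.derivCLM ℂ ℂ G) ξ = (2 * Real.pi * Complex.I * ξ) • 𝓕 G ξ := by
    rw [SchwartzMap.fourier_coe, SchwartzMap.fourier_coe]
    have h := Real.fourier_deriv (f := G) G.integrable G.differentiable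
      (SchwartzMap.derivCLM ℂ ℂ G).integrable
    exact congrFun h ξ
  rw [halfSubDeriv, sub_eq_add_neg, FourierTransform.fourier_add, FourierTransform.fourier_neg,
    FourierTransform.fourier_smul]
  simp only [add_apply, neg_apply, smul_apply, h1, smul_eq_mul]
  push_cast
  ring

theorem hasTemperateGrowth_inv_half_sub :
    (fun ξ : ℝ => (1 / 2 - Complex.I * (ξ * (2 * Real.pi) : ℝ))⁻¹).HasTemperateGrowth := by
  -- The inverse is the conjugate over the squared modulus, and `1/4 + (2πξ)² = (1 + (4πξ)²) / 4`.
  have h1 : (fun ξ : ℝ => ((4 * (1 + ‖(4 * Real.pi) * ξ‖ ^ 2) ^ (-1 : ℝ) : ℝ) : ℂ) *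
      (1 / 2 + Complex.I * (ξ * (2 * Real.pi) : ℝ))).HasTemperateGrowth := by
    have h2 : (fun ξ : ℝ => (4 * Real.pi) * ξ).HasTemperateGrowth := by fun_prop
    have h3 := (Function.hasTemperateGrowth_one_add_norm_sq_rpow ℝ (-1)).comp h2
    have h4 := Function.Complex.hasTemperateGrowth_ofReal.comp h3
    simp only [Function.comp_def] at h4
    fun_prop
  convert h1 using 2 with ξ
  have h0 := half_sub_ne_zero (ξ * (2 * Real.pi))
  rw [Real.rpow_neg_one]
  have : 0 < 1 + ‖(4 * Real.pi) * ξ‖ ^ 2 := by positivity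
  have key : (1 / 2 - Complex.I * (ξ * (2 * Real.pi) : ℝ)) *
      (1 / 2 + Complex.I * (ξ * (2 * Real.pi) : ℝ)) =
        ((4⁻¹ * (1 + ‖(4 * Real.pi) * ξ‖ ^ 2) : ℝ) : ℂ) := by
    rw [Real.norm_eq_abs, sq_abs]
    push_cast
    linear_combination (-(ξ * (2 * Real.pi)) ^ 2 : ℂ) * Complex.I_sq
  apply inv_eq_of_mul_eq_one_right
  rw [mul_left_comm, key, ← Complex.ofReal_mul, Complex.ofReal_eq_one]
  field_simp

/-- The symbol has no real zero and its inverse has temperate growth, so dividing by it on the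
Fourier side stays in the Schwartz space. -/
theorem halfSubDeriv_surjective : Function.Surjective halfSubDeriv := by
  intro H
  refine ⟨𝓕⁻ (SchwartzMap.smulLeftCLM ℂ
    (fun ξ : ℝ => (1 / 2 - Complex.I * (ξ * (2 * Real.pi) : ℝ))⁻¹) (𝓕 H)), ?_⟩
  apply (FourierTransform.fourierEquiv ℂ (SchwartzMap ℝ ℂ)).injective
  ext ξ
  simp only [FourierTransform.fourierEquiv_apply]
  rw [fourier_halfSubDeriv, FourierTransform.fourier_fourierInv_eq,
    SchwartzMap.smulLeftCLM_apply_apply hasTemperateGrowth_inv_half_sub, smul_eq_mul,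
    mul_inv_cancel_left₀ (half_sub_ne_zero _)]

/-- The unitary equivalence carrying `1 - C` to multiplication by `φ`. -/
def spectralMap : L2I ≃ₗᵢ[ℂ] L2R := Phi.trans fourierL2

/-- By density and continuity it suffices to treat `Φ f` Schwartz, hence of the form `G / 2 - G'`.
There `C` returns `Φ⁻¹ G`, which on the Fourier side is division by `1 / 2 - is`, that is,
multiplication by `1 - φ`. -/
theorem spectralMap_cesaro (f : L2I) :
    spectralMap (cesaro f) = spectralMap f - phiMul 1 (spectralMap f) := by
  obtain ⟨g, rfl⟩ := Phi.symm.surjective f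
  refine DenseRange.induction_on (SchwartzMap.denseRange_toLpCLM (F := ℂ) (p := 2)
    (μ := (volume : Measure ℝ)) ENNReal.ofNat_ne_top) g ?_ ?_
  · refine isClosed_eq ?_ ?_
    · exact spectralMap.continuous.comp (cesaro.continuous.comp Phi.symm.continuous)
    · have h := spectralMap.continuous.comp Phi.symm.continuous
      exact h.sub ((phiMul 1).continuous.comp h)
  · intro H
    obtain ⟨G, rfl⟩ := halfSubDeriv_surjective H
    rw [SchwartzMap.toLpCLM_apply, cesaro_Phi_symm G _ (halfSubDeriv_apply G)]
    simp only [spectralMap, LinearIsometryEquiv.trans_apply, LinearIsometryEquiv.apply_symm_apply]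
    apply Lp.ext
    filter_upwards [coeFn_fourierL2 G, coeFn_fourierL2 (halfSubDeriv G),
      coeFn_phiMul 1 (fourierL2 ((halfSubDeriv G).toLp 2)),
      Lp.coeFn_sub (fourierL2 ((halfSubDeriv G).toLp 2))
        (phiMul 1 (fourierL2 ((halfSubDeriv G).toLp 2)))] with s a b c d
    rw [d, Pi.sub_apply, c, zpow_one, ← one_sub_mul, one_sub_phi, a, b, fourier_halfSubDeriv,
      div_mul_cancel₀ _ (by positivity)]
    have := half_sub_ne_zero s
    rw [mul_left_comm _ (1 / 2 - Complex.I * (s : ℂ)), one_div_mul_eq_div,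
      mul_div_cancel_left₀ _ this]

/-! ### The Hardy space -/

theorem mem_indicatorL2_iff (A : Set ℝ) (f : L2R) :
    f ∈ indicatorL2 A ↔ ∀ᵐ s, s ∉ A → f s = 0 := by
  constructor
  · rintro ⟨g, -, h⟩
    filter_upwards [h] with s hs hA
    rw [hs, indicator_of_notMem hA, zero_mul]
  · intro h
    refine ⟨f, trivial, ?_⟩
    filter_upwards [h] with s hs
    by_cases hA : s ∈ A
    · simp [hA]
    · simp [hA, hs hA]

theorem mem_fourierInvSubspace_iff (N : Submodule ℂ L2R) (f : L2R) :
    f ∈ fourierInvSubspace N ↔ fourierL2 f ∈ N := by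
  constructor
  · rintro ⟨g, hg, rfl⟩
    change fourierL2 (fourierL2.symm g) ∈ N
    rwa [LinearIsometryEquiv.apply_symm_apply]
  · intro h
    exact ⟨fourierL2 f, h, fourierL2.symm_apply_apply f⟩

theorem mem_phiInvSubspace_iff (N : Submodule ℂ L2R) (f : L2I) :
    f ∈ phiInvSubspace N ↔ Phi f ∈ N := by
  constructor
  · rintro ⟨g, hg, rfl⟩
    change Phi (Phi.symm g) ∈ N
    rwa [LinearIsometryEquiv.apply_symm_apply]
  · intro h
    exact ⟨Phi f, h, Phi.symm_apply_apply f⟩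

theorem isClosed_indicatorL2 (A : Set ℝ) (hA : MeasurableSet A) :
    IsClosed (indicatorL2 A : Set L2R) := by
  have h : (indicatorL2 A : Set L2R) =
      ((LpToLpRestrictCLM ℝ ℂ ℂ volume 2 Aᶜ).ker : Set L2R) := by
    ext f
    rw [SetLike.mem_coe, mem_indicatorL2_iff, SetLike.mem_coe, LinearMap.mem_ker,
      Lp.eq_zero_iff_ae_eq_zero]
    refine (ae_restrict_iff' (p := fun s => f s = 0) hA.compl).symm.trans ?_
    refine Filter.eventually_congr ?_
    filter_upwards [LpToLpRestrictCLM_coeFn ℂ Aᶜ f] with s hs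
    rw [ContinuousLinearMap.coe_coe, hs, Pi.zero_apply]
  rw [h]
  exact ContinuousLinearMap.isClosed_ker _

theorem isChangeOfVariables_neg :
    IsChangeOfVariables volume volume (fun _ => 1) (fun s => -s) (fun s => -s) where
  measurable_w := measurable_const
  measurable_τ := measurable_neg
  measurable_σ := measurable_neg
  w_ne_zero _ := one_ne_zero
  left_inv u := neg_neg u
  lintegral_eq g := by
    simp only [enorm_one, one_pow, one_mul]
    exact (lintegral_neg_eq_self g).symm

/-- Reflection is what `𝓕²` amounts to. It is needed because `𝓗²` is defined by one more Fourier
transform on the space where `φ` acts, so that membership of `𝓕 g` in `𝓗²` is a support condition on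
`g`. -/
theorem fourierL2_fourierL2 (g : L2R) :
    fourierL2 (fourierL2 g) = isChangeOfVariables_neg.toEquiv g := by
  refine DenseRange.induction_on (SchwartzMap.denseRange_toLpCLM (F := ℂ) (p := 2)
    (μ := (volume : Measure ℝ)) ENNReal.ofNat_ne_top) g ?_ ?_
  · exact isClosed_eq (fourierL2.continuous.comp fourierL2.continuous)
      isChangeOfVariables_neg.toEquiv.continuous
  · intro G
    have hpi : (2 * Real.pi) ≠ 0 := by positivity
    let D : ℝ ≃L[ℝ] ℝ :=
      ContinuousLinearEquiv.unitsEquivAut ℝ (Units.mk0 (2 * Real.pi)⁻¹ (inv_ne_zero hpi))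
    let E : SchwartzMap ℝ ℂ := (((√(2 * Real.pi))⁻¹ : ℝ) : ℂ) •
      SchwartzMap.compCLMOfContinuousLinearEquiv ℂ D (𝓕 G)
    have hE : ∀ s, E s = (((√(2 * Real.pi))⁻¹ : ℝ) : ℂ) * 𝓕 G (s / (2 * Real.pi)) := by
      intro s
      simp [E, D, div_eq_mul_inv]
    have h1 : fourierL2 (G.toLp 2) = E.toLp 2 := by
      apply Lp.ext
      filter_upwards [coeFn_fourierL2 G, E.coeFn_toLp 2 volume] with s a b
      rw [a, b, hE]
    -- Undoing the dilation multiplies the integral by `2π`; with the factor `(2π)^(-1/2)` in `E`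
    -- this leaves `√(2π)`, which the prefactor of the second transform cancels.
    have h2 : ∀ s, 𝓕 E (s / (2 * Real.pi)) = ((√(2 * Real.pi) : ℝ) : ℂ) * G (-s) := by
      intro s
      have h3 : G (-s) = 𝓕 (𝓕 G) s := by
        have h4 : 𝓕⁻ (𝓕 G) (-s) = G (-s) := by rw [FourierTransform.fourierInv_fourier_eq]
        rw [← h4, SchwartzMap.fourierInv_apply_eq]
        simp
      rw [h3, SchwartzMap.fourier_coe, SchwartzMap.fourier_coe (𝓕 G), Real.fourier_eq',
        Real.fourier_eq']
      have h5 := Measure.integral_comp_div (fun v : ℝ =>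
        Complex.exp (((-2 * Real.pi * inner ℝ v s : ℝ) : ℂ) * Complex.I) • 𝓕 G v) (2 * Real.pi)
      rw [abs_of_pos (by positivity)] at h5
      have h6 : ∀ v : ℝ, Complex.exp (((-2 * Real.pi * inner ℝ v (s / (2 * Real.pi)) : ℝ) : ℂ) *
          Complex.I) • E v = (((√(2 * Real.pi))⁻¹ : ℝ) : ℂ) *
            (Complex.exp (((-2 * Real.pi * inner ℝ (v / (2 * Real.pi)) s : ℝ) : ℂ) * Complex.I) •
              𝓕 G (v / (2 * Real.pi))) := by
        intro v
        rw [hE, smul_eq_mul, smul_eq_mul, mul_left_comm]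
        congr 6
        simp only [RCLike.inner_apply, conj_trivial]
        ring
      simp only [h6]
      rw [integral_const_mul, h5, Complex.real_smul, ← mul_assoc, ← Complex.ofReal_mul]
      congr 2
      rw [inv_mul_eq_iff_eq_mul₀ (by positivity), Real.mul_self_sqrt (by positivity)]
    rw [SchwartzMap.toLpCLM_apply, h1]
    apply Lp.ext
    filter_upwards [coeFn_fourierL2 E, isChangeOfVariables_neg.coeFn_toEquiv (G.toLp 2),
      isChangeOfVariables_neg.congr (G.coeFn_toLp 2 volume)] with s a b c
    rw [a, b, c, h2, weightedComp, one_mul, ← mul_assoc, ← Complex.ofReal_mul,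
      inv_mul_cancel₀ (by positivity), Complex.ofReal_one, one_mul]

theorem fourierL2_mem_hardy_iff (g : L2R) : fourierL2 g ∈ hardy ↔ ∀ᵐ s, 0 ≤ s → g s = 0 := by
  rw [hardy, mem_fourierInvSubspace_iff, mem_indicatorL2_iff, fourierL2_fourierL2]
  have h1 : (∀ᵐ s, s ∉ Ioi (0 : ℝ) → isChangeOfVariables_neg.toEquiv g s = 0) ↔
      ∀ᵐ s : ℝ, 0 ≤ -s → g (-s) = 0 := by
    refine Filter.eventually_congr ?_
    filter_upwards [isChangeOfVariables_neg.coeFn_toEquiv g] with s hs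
    rw [hs, weightedComp, one_mul, mem_Ioi, not_lt, neg_nonneg]
  rw [h1, isChangeOfVariables_neg.ae_iff (p := fun s => 0 ≤ s → g s = 0)]
  simp only [imp_iff_not_or]
  exact (measurableSet_le measurable_const measurable_id).compl.union
    ((Lp.stronglyMeasurable g).measurable (measurableSet_singleton 0))

/-- The decreasing substitution `x = 1 / (1 + eᵘ)` carries `u ≥ 0` to `x ≤ 1/2`. -/
theorem spectralMap_mem_hardy_iff (k : L2I) :
    spectralMap k ∈ hardy ↔ ∀ᵐ x ∂(volume.restrict (Ioo (0 : ℝ) 1)), x ≤ 1 / 2 → k x = 0 := by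
  have hc := isChangeOfVariables_logistic
  rw [spectralMap, LinearIsometryEquiv.trans_apply, fourierL2_mem_hardy_iff,
    hc.ae_iff (p := fun x => x ≤ 1 / 2 → k x = 0)]
  · refine Filter.eventually_congr ?_
    filter_upwards [coeFn_Phi k] with u hu
    rw [hu, mul_eq_zero, or_iff_right (hc.w_ne_zero u)]
    have : 0 ≤ u ↔ 1 / (1 + Real.exp u) ≤ 1 / 2 := by
      rw [one_div_le_one_div (by positivity) (by norm_num), ← Real.one_le_exp_iff]
      constructor <;> intro h <;> linarith
    rw [this]
  · simp only [imp_iff_not_or]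
    exact (measurableSet_le measurable_id measurable_const).compl.union
      ((Lp.stronglyMeasurable k).measurable (measurableSet_singleton 0))

theorem isClosed_hardy : IsClosed (hardy : Set L2R) := by
  have : (hardy : Set L2R) = fourierL2 ⁻¹' (indicatorL2 (Ioi 0)) := by
    ext f; exact mem_fourierInvSubspace_iff _ f
  rw [this]
  exact (isClosed_indicatorL2 _ measurableSet_Ioi).preimage fourierL2.continuous

/-- In `L²(0, 1)` the claim is that `C` preserves vanishing on `(0, 1/2]`, which is clear as `C f
(x)` depends only on `f` on `(0, x)`. -/
theorem phiMul_mem_hardy : ∀ f ∈ hardy, phiMul 1 f ∈ hardy := by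
  intro f hf
  obtain ⟨k, rfl⟩ := spectralMap.surjective f
  have h1 : spectralMap (cesaro k) ∈ hardy := by
    rw [spectralMap_mem_hardy_iff] at hf ⊢
    filter_upwards [coeFn_cesaro k, ae_restrict_mem measurableSet_Ioo] with x hx hx1 hx2
    rw [hx, cesaroFun, intervalIntegral.integral_of_le hx1.1.le, integral_eq_zero_of_ae, mul_zero]
    have := ae_restrict_of_ae_restrict_of_subset
      (show Ioc 0 x ⊆ Ioo (0 : ℝ) 1 from fun t ht => ⟨ht.1, ht.2.trans_lt hx1.2⟩) hf
    filter_upwards [this, ae_restrict_mem measurableSet_Ioc] with t ht ht1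
    rw [ht (ht1.2.trans hx2), zero_div]; rfl
  rw [spectralMap_cesaro] at h1
  simpa using hardy.sub_mem hf h1

/-- If `φ⁻¹ 𝓗² ⊆ 𝓗²`, then the orthogonal complement of `𝓗²` is `φ`-invariant, so `C` preserves the
functions supported in `(0, 1/2]`. But the integral in `C` carries mass to the right of `1/2`. -/
theorem exists_phiMul_neg_one_notMem_hardy : ∃ f ∈ hardy, phiMul (-1) f ∉ hardy := by
  by_contra! H
  have hm : ∀ (a : ℝ → ℂ) (_ : Measurable a) (_ : ∀ x ∈ Ioo (0 : ℝ) 1, ‖a x‖ ≤ 1),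
      MemLp a 2 (volume.restrict (Ioo (0 : ℝ) 1)) := by
    intro a ha h
    refine MemLp.of_bound ha.aestronglyMeasurable 1 ?_
    filter_upwards [ae_restrict_mem measurableSet_Ioo] with x hx using h x hx
  -- The factors `1 - t` and `t` cancel the weights `1 / (1 - t)` and `1 / x` in `C`, so the pairing
  -- of `b` with `C a` is the integral of the constant `1/2` over `(1/2, 1)`.
  let a : ℝ → ℂ := (Iic (1 / 2 : ℝ)).indicator fun t => 1 - (t : ℂ)
  let b : ℝ → ℂ := (Ioi (1 / 2 : ℝ)).indicator fun t => (t : ℂ)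
  have ha : MemLp a 2 (volume.restrict (Ioo (0 : ℝ) 1)) := by
    refine hm a ((by fun_prop : Measurable fun t : ℝ => 1 - (t : ℂ)).indicator measurableSet_Iic)
      fun x hx => (norm_indicator_le_norm_self _ _).trans ?_
    rw [show (1 - (x : ℂ)) = ((1 - x : ℝ) : ℂ) by push_cast; rfl, Complex.norm_real,
      Real.norm_of_nonneg (by linarith [hx.2])]
    linarith [hx.1]
  have hb : MemLp b 2 (volume.restrict (Ioo (0 : ℝ) 1)) := by
    refine hm b ((by fun_prop : Measurable fun t : ℝ => (t : ℂ)).indicator measurableSet_Ioi)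
      fun x hx => (norm_indicator_le_norm_self _ _).trans ?_
    rw [Complex.norm_real, Real.norm_of_nonneg hx.1.le]
    exact hx.2.le
  have hbH : spectralMap (hb.toLp b) ∈ hardy := by
    rw [spectralMap_mem_hardy_iff]
    filter_upwards [hb.coeFn_toLp] with x hx hx2
    rw [hx]
    exact indicator_of_notMem (by simpa using hx2) _
  have hperp : ∀ f ∈ hardy, inner ℂ f (spectralMap (ha.toLp a)) = 0 := by
    intro f hf
    obtain ⟨k, rfl⟩ := spectralMap.surjective f
    rw [spectralMap_mem_hardy_iff] at hf
    rw [LinearIsometryEquiv.inner_map_map, L2.inner_def]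
    refine integral_eq_zero_of_ae ?_
    filter_upwards [hf, ha.coeFn_toLp] with x h1 h2
    rw [h2]
    by_cases h3 : x ≤ 1 / 2
    · rw [h1 h3, inner_zero_left]; rfl
    · have : a x = 0 := indicator_of_notMem (by simpa using h3) _
      rw [this, inner_zero_right]; rfl
  have h0 : inner ℂ (hb.toLp b) (cesaro (ha.toLp a)) = 0 := by
    rw [← LinearIsometryEquiv.inner_map_map spectralMap, spectralMap_cesaro, inner_sub_right,
      hperp _ hbH, ← neg_neg (1 : ℤ), ← inner_phiMul_left, hperp _ (H _ hbH), sub_zero]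
  have h1 : inner ℂ (hb.toLp b) (cesaro (ha.toLp a)) =
      ∫ x in Ioo (0 : ℝ) 1, (Ioi (1 / 2 : ℝ)).indicator (fun _ => (1 / 2 : ℂ)) x := by
    rw [L2.inner_def]
    refine integral_congr_ae ?_
    filter_upwards [hb.coeFn_toLp, coeFn_cesaro (ha.toLp a), ae_restrict_mem measurableSet_Ioo]
      with x h2 h3 hx
    rw [h2, h3, cesaroFun_congr ha.coeFn_toLp hx]
    by_cases h4 : x ∈ Ioi (1 / 2 : ℝ)
    · have h5 : ∫ t in (0 : ℝ)..x, a t / (1 - (t : ℂ)) = 1 / 2 := by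
        rw [intervalIntegral.integral_of_le hx.1.le]
        have h6 : ∀ t ∈ Ioc 0 x, a t / (1 - (t : ℂ)) =
            (Iic (1 / 2 : ℝ)).indicator (fun _ => (1 : ℂ)) t := by
          intro t ht
          by_cases h7 : t ∈ Iic (1 / 2 : ℝ)
          · simp only [a, indicator_of_mem h7]
            refine div_self ?_
            have : 1 - t ≠ 0 := by linarith [ht.2, hx.2]
            exact_mod_cast this
          · simp only [a, indicator_of_notMem h7, zero_div]
        rw [setIntegral_congr_fun measurableSet_Ioc h6, setIntegral_indicator measurableSet_Iic,
          Ioc_inter_Iic, min_eq_right (mem_Ioi.1 h4).le]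
        simp
      rw [cesaroFun, h5]
      simp only [b, indicator_of_mem h4, RCLike.inner_apply, Complex.conj_ofReal]
      have : (x : ℂ) ≠ 0 := by exact_mod_cast hx.1.ne'
      field_simp
    · simp only [b, indicator_of_notMem h4, inner_zero_left]
  rw [h0, setIntegral_indicator measurableSet_Ioi, Ioo_inter_Ioi, setIntegral_const] at h1
  norm_num [Measure.real] at h1

/-! ### Transfer of invariance between `L²(0, 1)` and the Fourier side. -/

theorem cesaro_invariant_iff_phiMul_invariant {N : Submodule ℂ L2R} {M : Submodule ℂ L2I}
    (hM : ∀ f, f ∈ M ↔ spectralMap f ∈ N) :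
    (∀ f ∈ M, cesaro f ∈ M) ↔ ∀ g ∈ N, phiMul 1 g ∈ N := by
  constructor
  · intro h g hg
    obtain ⟨f, rfl⟩ := spectralMap.surjective g
    have h1 := (hM _).1 (h f ((hM f).2 hg))
    rw [spectralMap_cesaro] at h1
    simpa using N.sub_mem hg h1
  · intro h f hf
    rw [hM] at hf ⊢
    rw [spectralMap_cesaro]
    exact N.sub_mem hf (h _ hf)

theorem eq_phiInvSubspace_iff (N : Submodule ℂ L2R) (M : Submodule ℂ L2I) :
    M = phiInvSubspace (fourierInvSubspace N) ↔ ∀ f, f ∈ M ↔ spectralMap f ∈ N := by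
  simp only [SetLike.ext_iff, mem_phiInvSubspace_iff, mem_fourierInvSubspace_iff]
  rfl

theorem phiMul_mem_indicatorL2 (A : Set ℝ) : ∀ g ∈ indicatorL2 A, phiMul 1 g ∈ indicatorL2 A := by
  intro g hg
  rw [mem_indicatorL2_iff] at hg ⊢
  filter_upwards [hg, coeFn_phiMul 1 g] with s a b h
  rw [b, a h, mul_zero]

theorem phiMul_mem_of_neg_one {N : Submodule ℂ L2R} (h1 : ∀ f ∈ N, phiMul 1 f ∈ N)
    (h2 : ∀ f ∈ N, phiMul (-1) f ∈ N) (n : ℤ) : ∀ f ∈ N, phiMul n f ∈ N := by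
  induction n with
  | zero => intro f hf; rwa [phiMul_zero]
  | succ k ih => intro f hf; rw [← phiMul_phiMul]; exact ih _ (h1 f hf)
  | pred k ih => intro f hf; rw [sub_eq_add_neg, ← phiMul_phiMul]; exact ih _ (h2 f hf)

end CesaroL2

end

theorem mainTheorem10 (M : Submodule ℂ CesaroL2.L2I) (hM : IsClosed (M : Set CesaroL2.L2I)) :
    (∀ f ∈ M, CesaroL2.cesaro f ∈ M) ↔
      (∃ A : Set ℝ, MeasurableSet A ∧
        M = CesaroL2.phiInvSubspace (CesaroL2.fourierInvSubspace (CesaroL2.indicatorL2 A))) ∨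
      (∃ q : ℝ → ℂ, Measurable q ∧ (∀ x, ‖q x‖ = 1) ∧
        M = CesaroL2.phiInvSubspace (CesaroL2.fourierInvSubspace
          (CesaroL2.mulSubspace q CesaroL2.hardy))) := by
  simp only [CesaroL2.eq_phiInvSubspace_iff]
  constructor
  · intro h
    let N : Submodule ℂ CesaroL2.L2R :=
      M.comap CesaroL2.spectralMap.symm.toLinearEquiv.toLinearMap
    have hMN : ∀ f, f ∈ M ↔ CesaroL2.spectralMap f ∈ N := fun f => by
      change _ ↔ CesaroL2.spectralMap.symm (CesaroL2.spectralMap f) ∈ M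
      rw [LinearIsometryEquiv.symm_apply_apply]
    have hc : IsClosed (N : Set CesaroL2.L2R) := hM.preimage CesaroL2.spectralMap.symm.continuous
    have hN := (CesaroL2.cesaro_invariant_iff_phiMul_invariant hMN).1 h
    -- Either `φ N = N`, the reducing case, or `φ N` is a proper subspace of `N` and comparison with
    -- `𝓗²` applies.
    by_cases h2 : ∀ g ∈ N, CesaroL2.phiMul (-1) g ∈ N
    · obtain ⟨A, hA, hNA⟩ :=
        CesaroL2.exists_eq_indicatorL2 hc (CesaroL2.phiMul_mem_of_neg_one hN h2)
      exact Or.inl ⟨A, hA, hNA ▸ hMN⟩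
    · push Not at h2
      obtain ⟨g, hg, hg'⟩ := h2
      obtain ⟨g₂, hg₂, hg₂'⟩ := CesaroL2.exists_phiMul_neg_one_notMem_hardy
      obtain ⟨q, hq, hq1, hNq⟩ := CesaroL2.exists_eq_mulSubspace hc CesaroL2.isClosed_hardy hN
        CesaroL2.phiMul_mem_hardy hg hg₂ hg' hg₂'
      exact Or.inr ⟨q, hq, hq1, hNq ▸ hMN⟩
  · rintro (⟨A, -, hA⟩ | ⟨q, hq, hq1, hqM⟩)
    · exact (CesaroL2.cesaro_invariant_iff_phiMul_invariant hA).2 (CesaroL2.phiMul_mem_indicatorL2 A)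
    · exact (CesaroL2.cesaro_invariant_iff_phiMul_invariant hqM).2
        (CesaroL2.phiMul_mem_mulSubspace hq hq1 CesaroL2.phiMul_mem_hardy)
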